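/- Let $M>0$, $|a|\le M$, $s\in\frac12\mathbb{Z}$, and let $m$ be admissible with respect to $s$, i.e. $m\in\mathbb Z$ if $s\in\mathbb Z$ and $m\in\mathbb Z+\frac12$ if $s\in\mathbb Z+\frac12$. Put $\Delta(r)=r^2-2Mr+a^2$ and $r_+=M+\sqrt{M^2-a^2}$, and let $\lambda\in\mathbb R$. Suppose $am\neq0$. Let $R:(r_+,\infty)\to\mathbb C$ be a $C^2$ solution of the homogeneous radial Teukolsky equation $$\Delta^{-s}\frac{d}{dr}\Big(\Delta^{s+1}\frac{dR}{dr}\Big)+\frac{[\omega(r^2+a^2)-am]^2-2is(r-M)[\omega(r^2+a^2)-am]}{\Delta}R+\big(4is\omega r-\lambda-a^2\omega^2+2am\omega\big)R=0$$ with $\omega=0$. If $R$ has finite energy along a hyperboloidal hypersurface, then $R\equiv0$ on $(r_+,\infty)$. Here finite energy along a hyperboloidal hypersurface (a spacelike hypersurface from the future event horizon to future null infinity) is understood as follows. Let $\bar\phi(r)=\int_{3M}^r \frac{a}{\Delta}\,d\rho$ be the shift between the Boyer--Lindquist and the Kerr-star azimuthal angles, and let $\Psi=\Delta^{s}e^{-im\bar\phi}R$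 be the radial profile of the mode in Kerr-star coordinates and in a frame regular at the future horizon. Then $R$ has finite energy if 1. $\displaystyle\int_{r_+}^\infty\big(r^2|\Psi'(r)|^2+|\Psi(r)|^2\big)\,dr<\infty$; 2. for some $r_0>r_+$ and all integers $0\le j\le \max(0,\lfloor s\rfloor)+1$, $\displaystyle\int_{r_+}^{r_0}|\Psi^{(j)}(r)|^2\,dr<\infty$ (this follows from 1 if $s<1$); 3. if $s<0$, then $\lambda+s\ge-\frac14$ (which holds automatically when $\lambda$ is a separation constant, as then $\lambda+s=l(l+1)-s^2\ge 0$ with $l\ge|s|$). -/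

import Mathlib

open MeasureTheory Set

noncomputable section

namespace Kerr

/-- `Δ = r² - 2 M r + a²`. -/
def Delta (M a r : ℝ) : ℝ := r ^ 2 - 2 * M * r + a ^ 2

/-- The event horizon radius `r₊ = M + √(M² - a²)`. -/
def rPlus (M a : ℝ) : ℝ := M + Real.sqrt (M ^ 2 - a ^ 2)

/-- `s ∈ ½ℤ`. -/
def IsHalfIntegral (s : ℝ) : Prop := ∃ n : ℤ, 2 * s = n

/-- The azimuthal parameter `m` is admissible with respect to the spin `s ∈ ½ℤ`: both are integers,
or both are half-odd-integers. -/
def IsAdmissible (s m : ℝ) : Prop :=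
  ((∃ k : ℤ, s = k) ∧ ∃ j : ℤ, m = j) ∨
    ((∃ k : ℤ, s = k + 1 / 2) ∧ ∃ j : ℤ, m = j + 1 / 2)

/-- `R` is a classical solution on the exterior `(r₊, ∞)` of the homogeneous radial Teukolsky
equation of spin `s` with frequency parameters `(ω, m, lam)`:
`Δ⁻ˢ (Δˢ⁺¹ R')' + ((K² - 2 i s (r - M) K) / Δ + 4 i s ω r - lam - a² ω² + 2 a m ω) R = 0`,
where `K = ω (r² + a²) - a m`. Values of `R` on `(-∞, r₊]` are irrelevant. -/
def IsRadialSolution (M a s : ℝ) (ω : ℂ) (m : ℝ) (lam : ℂ) (R : ℝ → ℂ) : Prop :=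
  ContDiffOn ℝ 2 R (Ioi (rPlus M a)) ∧
  ∀ r : ℝ, rPlus M a < r →
    ((Delta M a r ^ (-s) : ℝ) : ℂ) *
        deriv (fun ρ : ℝ => ((Delta M a ρ ^ (s + 1) : ℝ) : ℂ) * deriv R ρ) r
      + (((ω * ((r : ℂ) ^ 2 + (a : ℂ) ^ 2) - a * m) ^ 2
            - 2 * Complex.I * s * (r - M) * (ω * ((r : ℂ) ^ 2 + (a : ℂ) ^ 2) - a * m))
          / (Delta M a r : ℂ)) * R r
      + (4 * Complex.I * s * ω * r - lam - (a : ℂ) ^ 2 * ω ^ 2 + 2 * a * m * ω) * R r = 0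

/-- The azimuthal shift `φ̄` between Boyer–Lindquist and Kerr-star coordinates, `φ* = φ + φ̄(r)`:
the primitive of `a / Δ` on `(r₊, ∞)` that vanishes at `r = 3M`. -/
def phiBar (M a r : ℝ) : ℝ := ∫ ρ in (3 * M)..r, a / Delta M a ρ

/-- The radial profile `Ψ = Δˢ e^{-i m φ̄} R` of the stationary (`ω = 0`) mode
`e^{i m φ} S(θ) R(r)`, taken in Kerr-star coordinates (regular at the future horizon,
`e^{i m φ} = e^{-i m φ̄(r)} e^{i m φ*}`) and in a frame that is regular at the future horizon
(factor `Δˢ`; outgoing waves then satisfy `Ψ = O(1/r)` at future null infinity for every `s`). -/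
def regularProfile (M a s m : ℝ) (R : ℝ → ℂ) (r : ℝ) : ℂ :=
  ((Delta M a r ^ s : ℝ) : ℂ) * Complex.exp (-(Complex.I * m * (phiBar M a r : ℂ))) * R r

/-- Finite energy along a hyperboloidal hypersurface (one crossing the future horizon and reaching
future null infinity) for the radial part `R` of a stationary (`ω = 0`) spin-`s` mode with azimuthal
number `m` and separation parameter `lam`. As the mode does not depend on time, only derivatives
along the hypersurface, with coordinates `(r, θ, φ*)`, enter.

* `energy`: the energy density is `r² |∂_r Ψ|²` plus the contribution `r² · r⁻² |Ψ|²` of the angular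
  derivatives, integrated over `r ∈ (r₊, ∞)`.
* `horizon`: near the horizon the energy is that of order `max(0, ⌊s⌋) + 1`. For `s < 1` this is
  again the first order energy; for `s ≥ 1` the first order energy alone does not distinguish the
  future horizon from the past one. Every profile smooth up to `r = r₊` satisfies it.
* `threshold`: for negative spin, the lower bound `lam + s ≥ -1/4`. Equivalently, the exponents
  `-(s + 1/2) ± ν`, `ν² = (s + 1/2)² + lam`, of `R` at infinity satisfy `ν ≥ |s|`. It holds for every
  separation constant, for which `lam + s = l (l + 1) - s² ≥ 0`. -/
structure HasFiniteHyperboloidalEnergy (M a s m lam : ℝ) (R : ℝ → ℂ) : Prop where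
  energy : IntegrableOn
    (fun r : ℝ => r ^ 2 * ‖deriv (regularProfile M a s m R) r‖ ^ 2
      + ‖regularProfile M a s m R r‖ ^ 2) (Ioi (rPlus M a))
  horizon : ∃ r₀ : ℝ, rPlus M a < r₀ ∧ ∀ j : ℕ, j ≤ ⌊s⌋₊ + 1 →
    IntegrableOn (fun r : ℝ => ‖iteratedDeriv j (regularProfile M a s m R) r‖ ^ 2)
      (Ioo (rPlus M a) r₀)
  threshold : s < 0 → -(1 / 4) ≤ lam + s

end Kerr

end

open Filter Topology Asymptotics

namespace Kerr

/-! With `κ = a m` and `c = λ + 2 s`, the regular profile `u = Ψ` solves `Δ u'' + ((1 - s) Δ' + 2 i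
κ) u' = c u`. This family of equations is closed under two operations: differentiation lowers `s` by
one (`IsProfileSolution.lower`), and `Δ u' + (-s Δ' + 2 i κ) u` raises it by one
(`IsProfileSolution.raise`). So every half-integral spin reduces to `s = 0` or `s = 1/2`, where a
quadratic conservation law is available.

For these two spins, decay at infinity makes the conserved quantity vanish. At the horizon, square
integrability of `u'` forces `Δ u' → 0`, because `1 / Δ` is not integrable there. For `s = 0` the
flux then leaves `κ |u|² → 0`, and this is where `a m ≠ 0` enters; for `s = 1/2` the law itself
kills the limit of `u` when `c > 0`, while `c ≤ 0` is immediate. In the remaining cases the law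
bounds `|u|` by the raised function, whose derivative is a multiple of `u`, so a contraction
argument (`eq_zero_of_tendsto_horizon`) gives `u = 0` near the horizon, and then everywhere by
uniqueness for the ODE.

For `s ≥ 0` one differentiates `⌊s⌋` times: decay only improves, and the higher order horizon
condition supplies the integrability. For `s < 0` one raises, which costs a power of `r`. That power
is regained from the asymptotics: the energy excludes the dominant branch at infinity, and the
threshold on `λ` leaves a gap down to the recessive one (`isLittleO_improve`,
`Vanishing.of_raised`). -/

lemma Delta_eq_mul (M a r : ℝ) (ha : |a| ≤ M) :
    Delta M a r = (r - rPlus M a) * (r - M + √(M ^ 2 - a ^ 2)) := by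
  have h : 0 ≤ M ^ 2 - a ^ 2 := by
    have := sq_le_sq' (by linarith [neg_abs_le a, abs_nonneg a]) (le_of_abs_le ha)
    linarith
  have h2 := Real.sq_sqrt h
  unfold Delta rPlus
  linear_combination h2

lemma Delta_pos {M a r : ℝ} (ha : |a| ≤ M) (hr : rPlus M a < r) : 0 < Delta M a r := by
  rw [Delta_eq_mul M a r ha]
  have h := Real.sqrt_nonneg (M ^ 2 - a ^ 2)
  unfold rPlus at *
  exact mul_pos (by linarith) (by linarith)

lemma rPlus_lt (M a : ℝ) (hM : 0 < M) : rPlus M a < 3 * M := by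
  have : √(M ^ 2 - a ^ 2) ≤ M := by
    rw [Real.sqrt_le_left hM.le]; nlinarith [sq_nonneg a]
  unfold rPlus; linarith

lemma Delta_rPlus (M a : ℝ) (ha : |a| ≤ M) : Delta M a (rPlus M a) = 0 := by
  rw [Delta_eq_mul _ _ _ ha]; simp

lemma hasDerivAt_Delta (M a r : ℝ) : HasDerivAt (Delta M a) (2 * (r - M)) r := by
  have h := (((hasDerivAt_id r).pow 2).sub ((hasDerivAt_id r).const_mul (2 * M))).add_const (a ^ 2)
  refine h.congr_deriv ?_
  simp; ring

lemma continuous_Delta (M a : ℝ) : Continuous (Delta M a) := by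
  unfold Delta; fun_prop

lemma hasDerivAt_Delta_ofReal (M a r : ℝ) :
    HasDerivAt (fun ρ : ℝ => (Delta M a ρ : ℂ)) (2 * (r - M)) r := by
  have := (hasDerivAt_Delta M a r).ofReal_comp
  push_cast at this
  exact this

/-! ### The profile equation and its spin-shifting operators -/

/-- `u` solves the radial equation `Δ u'' + ((1 - s) Δ' + 2 i κ) u' = c u` on the exterior, where
`v = u'`. -/
structure IsProfileSolution (M a κ s c : ℝ) (u v : ℝ → ℂ) : Prop where
  fst : ∀ r, rPlus M a < r → HasDerivAt u (v r) r
  snd : ∀ r, rPlus M a < r → HasDerivAt v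
    ((c * u r - ((1 - s) * (2 * (r - M)) + 2 * κ * Complex.I) * v r) / Delta M a r) r

/-- The spin-raising operator applied to `u`, where `v = u'`. -/
noncomputable def raised (M a κ s : ℝ) (u v : ℝ → ℂ) (r : ℝ) : ℂ :=
  Delta M a r * v r + (-s * (2 * (r - M)) + 2 * κ * Complex.I) * u r

namespace IsProfileSolution

variable {M a κ s c : ℝ} {u v : ℝ → ℂ}

/-- This is the profile equation in divergence form: since `Δ'' = 2`, moving `-s Δ'` under the
derivative costs only the constant `2 s`. -/
lemma hasDerivAt_raised (h : IsProfileSolution M a κ s c u v) (ha : |a| ≤ M) {r : ℝ}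
    (hr : rPlus M a < r) : HasDerivAt (raised M a κ s u v) ((c - 2 * s) * u r) r := by
  have hD : (Delta M a r : ℂ) ≠ 0 := by exact_mod_cast (Delta_pos ha hr).ne'
  have h1 : HasDerivAt (fun ρ : ℝ => -(s : ℂ) * (2 * ((ρ : ℂ) - M)) + 2 * κ * Complex.I)
      (-s * (2 * 1)) r :=
    (((((hasDerivAt_id r).ofReal_comp).sub_const (M : ℂ)).const_mul 2).const_mul
      (-(s : ℂ))).add_const _
  refine (((hasDerivAt_Delta_ofReal M a r).mul (h.snd r hr)).add
    (h1.mul (h.fst r hr))).congr_deriv ?_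
  field_simp
  ring

lemma raise (h : IsProfileSolution M a κ s c u v) (ha : |a| ≤ M) :
    IsProfileSolution M a κ (s + 1) (c - 2 * s) (raised M a κ s u v)
      (fun r => (c - 2 * s) * u r) where
  fst r hr := h.hasDerivAt_raised ha hr
  snd r hr := by
    have hD : (Delta M a r : ℂ) ≠ 0 := by exact_mod_cast (Delta_pos ha hr).ne'
    refine ((h.fst r hr).const_mul ((c : ℂ) - 2 * s)).congr_deriv ?_
    rw [raised]
    push_cast
    field_simp
    ring

/-- Differentiating the equation adds one `Δ'` to the first order coefficient and shifts `c` by the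
constant `(1 - s) Δ''`. -/
lemma lower (h : IsProfileSolution M a κ s c u v) (ha : |a| ≤ M) :
    IsProfileSolution M a κ (s - 1) (c - 2 * (1 - s)) v (fun r =>
      (c * u r - ((1 - s) * (2 * (r - M)) + 2 * κ * Complex.I) * v r) / Delta M a r) where
  fst r hr := h.snd r hr
  snd r hr := by
    have hD : (Delta M a r : ℂ) ≠ 0 := by exact_mod_cast (Delta_pos ha hr).ne'
    have h1 : HasDerivAt (fun ρ : ℝ => (1 - s : ℂ) * (2 * ((ρ : ℂ) - M)) + 2 * κ * Complex.I)
        ((1 - s) * (2 * 1)) r :=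
      (((((hasDerivAt_id r).ofReal_comp).sub_const (M : ℂ)).const_mul 2).const_mul
        (1 - s : ℂ)).add_const _
    refine ((((h.fst r hr).const_mul (c : ℂ)).sub (h1.mul (h.snd r hr))).div
      (hasDerivAt_Delta_ofReal M a r) hD).congr_deriv ?_
    push_cast
    simp only [Pi.sub_apply, Pi.mul_apply]
    field_simp
    ring

/-- Unique continuation for the profile equation. -/
lemma eq_zero_of_eq_zero (h : IsProfileSolution M a κ s c u v) (ha : |a| ≤ M) {r₁ : ℝ}
    (hr₁ : rPlus M a < r₁) (hu : u r₁ = 0) (hv : v r₁ = 0) {r : ℝ} (hr : r₁ ≤ r) : u r = 0 := by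
  -- A Grönwall constant for the first order system of the pair `(u, u')` in the sup norm; it is
  -- finite because `Δ` stays away from zero on `[r₁, r]`.
  obtain ⟨K, hK⟩ : ∃ K : ℝ, ∀ x ∈ Icc r₁ r, 1 + (‖(c : ℂ)‖ +
      ‖((1 - s) * (2 * (x - M)) + 2 * κ * Complex.I : ℂ)‖) / Delta M a x ≤ K := by
    have hc : ContinuousOn (fun x : ℝ => 1 + (‖(c : ℂ)‖ +
      ‖((1 - s) * (2 * (x - M)) + 2 * κ * Complex.I : ℂ)‖) / Delta M a x) (Icc r₁ r) := by
      refine continuousOn_const.add (ContinuousOn.div (by fun_prop)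
        (continuous_Delta M a).continuousOn fun x hx => (Delta_pos ha (hr₁.trans_le hx.1)).ne')
    obtain ⟨K, hK⟩ := isCompact_Icc.bddAbove_image hc
    exact ⟨K, fun x hx => hK ⟨x, hx, rfl⟩⟩
  have hlt : ∀ x ∈ Icc r₁ r, rPlus M a < x := fun x hx => hr₁.trans_le hx.1
  have key := norm_le_gronwallBound_of_norm_deriv_right_le (f := fun x => (u x, v x))
    (f' := fun x => (v x,
      (c * u x - ((1 - s) * (2 * (x - M)) + 2 * κ * Complex.I) * v x) / Delta M a x))
    (δ := 0) (K := K) (ε := 0) (a := r₁) (b := r)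
    (fun x hx => ((h.fst x (hlt x hx)).prodMk (h.snd x (hlt x hx))).continuousAt.continuousWithinAt)
    (fun x hx => ((h.fst x (hlt x (Ico_subset_Icc_self hx))).prodMk
      (h.snd x (hlt x (Ico_subset_Icc_self hx)))).hasDerivWithinAt)
    (by simp [hu, hv]) ?_ r ⟨hr, le_rfl⟩
  · rw [gronwallBound_ε0] at key
    simp only [zero_mul, norm_le_zero_iff, Prod.mk_eq_zero] at key
    exact key.1
  · intro x hx
    have hD := Delta_pos ha (hlt x (Ico_subset_Icc_self hx))
    have hK := hK x (Ico_subset_Icc_self hx)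
    set b : ℂ := (1 - s) * (2 * (x - M)) + 2 * κ * Complex.I
    have hN : ‖u x‖ ≤ ‖(u x, v x)‖ := norm_fst_le (u x, v x)
    have hN' : ‖v x‖ ≤ ‖(u x, v x)‖ := norm_snd_le (u x, v x)
    set N := ‖(u x, v x)‖
    have hN0 : 0 ≤ N := norm_nonneg _
    have hq : 0 ≤ (‖(c : ℂ)‖ + ‖b‖) / Delta M a x := by positivity
    have h2 : ‖(c * u x - b * v x) / Delta M a x‖ ≤ (‖(c : ℂ)‖ + ‖b‖) / Delta M a x * N := by
      rw [norm_div, Complex.norm_real, Real.norm_of_nonneg hD.le, div_mul_eq_mul_div]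
      gcongr
      calc _ ≤ ‖(c : ℂ) * u x‖ + ‖b * v x‖ := norm_sub_le _ _
        _ ≤ ‖(c : ℂ)‖ * N + ‖b‖ * N := by rw [norm_mul, norm_mul]; gcongr
        _ = _ := by ring
    rw [add_zero, Prod.norm_def]
    have h3 : (1 + (‖(c : ℂ)‖ + ‖b‖) / Delta M a x) * N ≤ K * N := by gcongr
    refine max_le ?_ ?_ <;> nlinarith

end IsProfileSolution

/-! ### Power-law estimates at infinity -/

section Asymptotics

lemma rpow_isBigO_rpow {p q : ℝ} (h : p ≤ q) :
    (fun r : ℝ => r ^ p) =O[atTop] fun r : ℝ => r ^ q := by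
  refine IsBigO.of_bound 1 ?_
  filter_upwards [eventually_ge_atTop 1] with r hr
  have h0 : 0 ≤ r := by linarith
  rw [one_mul, Real.norm_of_nonneg (Real.rpow_nonneg h0 _),
    Real.norm_of_nonneg (Real.rpow_nonneg h0 _)]
  exact Real.rpow_le_rpow_of_exponent_le hr h

lemma mul_isLittleO_rpow {f g : ℝ → ℂ} {p q t : ℝ} (hf : f =O[atTop] fun r : ℝ => r ^ p)
    (hg : g =o[atTop] fun r : ℝ => r ^ q) (ht : p + q ≤ t) :
    (fun r => f r * g r) =o[atTop] fun r : ℝ => r ^ t := by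
  refine ((hf.mul_isLittleO hg).congr' EventuallyEq.rfl ?_).trans_isBigO (rpow_isBigO_rpow ht)
  filter_upwards [eventually_gt_atTop 0] with r hr
  rw [Real.rpow_add hr]

lemma ofReal_rpow_isBigO (p : ℝ) :
    (fun r : ℝ => ((r ^ p : ℝ) : ℂ)) =O[atTop] fun r : ℝ => r ^ p :=
  IsBigO.of_bound 1 (Eventually.of_forall fun r => by simp)

lemma const_isBigO_rpow_zero (z : ℂ) : (fun _ : ℝ => z) =O[atTop] fun r : ℝ => r ^ (0 : ℝ) := by
  simp only [Real.rpow_zero]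
  exact isBigO_const_const z one_ne_zero _

lemma ofReal_isBigO : (fun r : ℝ => (r : ℂ)) =O[atTop] fun r : ℝ => r ^ (1 : ℝ) :=
  IsBigO.of_bound 1 (Eventually.of_forall fun r => by simp)

lemma linear_isBigO (z w : ℂ) :
    (fun r : ℝ => z * (r : ℂ) + w) =O[atTop] fun r : ℝ => r ^ (1 : ℝ) :=
  (ofReal_isBigO.const_mul_left z).add
    ((const_isBigO_rpow_zero w).trans (rpow_isBigO_rpow zero_le_one))

lemma Delta_isBigO (M a : ℝ) (hM : 0 < M) :
    (fun r : ℝ => (Delta M a r : ℂ)) =O[atTop] fun r : ℝ => r ^ (2 : ℝ) := by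
  refine IsBigO.of_bound 2 ?_
  filter_upwards [eventually_ge_atTop (4 * M + |a|)] with r hr
  have ha := abs_nonneg a
  have h2 : a ^ 2 ≤ r ^ 2 := sq_le_sq' (by linarith [neg_abs_le a]) (by linarith [le_abs_self a])
  rw [Complex.norm_real, Real.rpow_two, Real.norm_eq_abs, Real.norm_eq_abs, abs_of_nonneg (sq_nonneg r)]
  unfold Delta
  rw [abs_le]
  constructor <;> nlinarith

lemma Delta_inv_isBigO (M a : ℝ) (hM : 0 < M) :
    (fun r : ℝ => (Delta M a r : ℂ)⁻¹) =O[atTop] fun r : ℝ => r ^ (-2 : ℝ) := by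
  refine IsBigO.of_bound 2 ?_
  filter_upwards [eventually_ge_atTop (4 * M)] with r hr
  have hr0 : 0 < r := by linarith
  have h1 : r ^ 2 / 2 ≤ Delta M a r := by unfold Delta; nlinarith [sq_nonneg a]
  have h2 : 0 < r ^ 2 / 2 := by positivity
  rw [norm_inv, Complex.norm_real, Real.norm_of_nonneg (h2.le.trans h1), Real.rpow_neg hr0.le,
    Real.rpow_two, Real.norm_of_nonneg (by positivity)]
  calc (Delta M a r)⁻¹ ≤ (r ^ 2 / 2)⁻¹ := inv_anti₀ h2 h1
    _ = _ := by field_simp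

lemma isLittleO_rpow_of_deriv_of_pos {f f' : ℝ → ℂ} {α : ℝ} (hα : 0 < α)
    (hf : ∀ᶠ r in atTop, HasDerivAt f (f' r) r) (h : f' =o[atTop] fun r : ℝ => r ^ (α - 1)) :
    f =o[atTop] fun r : ℝ => r ^ α := by
  rw [isLittleO_iff]
  intro ε hε
  obtain ⟨r₀, hr₀⟩ := eventually_atTop.1
    (hf.and (((isLittleO_iff.1 h) (show 0 < ε / 2 * α by positivity)).and (eventually_gt_atTop 0)))
  filter_upwards [eventually_ge_atTop r₀,
    (tendsto_rpow_atTop hα).eventually_ge_atTop (‖f r₀‖ / (ε / 2))] with r hr hr'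
  have hpos : 0 < r₀ := (hr₀ r₀ le_rfl).2.2
  have key := image_norm_le_of_norm_deriv_right_le_deriv_boundary' (f := f) (f' := f') (a := r₀)
    (b := r) (B := fun x => ‖f r₀‖ + ε / 2 * (x ^ α - r₀ ^ α))
    (B' := fun x => ε / 2 * (α * x ^ (α - 1)))
    (fun x hx => (hr₀ x hx.1).1.continuousAt.continuousWithinAt)
    (fun x hx => (hr₀ x hx.1).1.hasDerivWithinAt) (by simp)
    (fun x hx => ((((Real.hasDerivAt_rpow_const (Or.inl (hpos.trans_le hx.1).ne')).sub_const
      _).const_mul _).const_add _).continuousAt.continuousWithinAt)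
    (fun x hx => ((((Real.hasDerivAt_rpow_const (Or.inl (hpos.trans_le hx.1).ne')).sub_const
      _).const_mul _).const_add _).hasDerivWithinAt)
    (fun x hx => by
      have h1 := (hr₀ x hx.1).2.1
      rw [Real.norm_of_nonneg (Real.rpow_nonneg (hpos.trans_le hx.1).le _)] at h1
      linarith) (right_mem_Icc.2 hr)
  rw [Real.norm_of_nonneg (Real.rpow_nonneg (hpos.le.trans hr) _)]
  rw [div_le_iff₀ (by positivity)] at hr'
  have : 0 ≤ ε / 2 * r₀ ^ α := by positivity
  linarith

lemma isLittleO_rpow_of_deriv_of_neg {f f' : ℝ → ℂ} {α : ℝ} (hα : α < 0)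
    (hf : ∀ᶠ r in atTop, HasDerivAt f (f' r) r) (h : f' =o[atTop] fun r : ℝ => r ^ (α - 1))
    (h0 : Tendsto f atTop (𝓝 0)) : f =o[atTop] fun r : ℝ => r ^ α := by
  rw [isLittleO_iff]
  intro ε hε
  obtain ⟨r₀, hr₀⟩ := eventually_atTop.1
    (hf.and (((isLittleO_iff.1 h) (show 0 < ε * -α by nlinarith)).and (eventually_gt_atTop 0)))
  filter_upwards [eventually_ge_atTop r₀] with r hr
  have hpos : 0 < r := (hr₀ r hr).2.2
  have key : ∀ᶠ t in atTop, ‖f t - f r‖ ≤ ε * r ^ α := by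
    filter_upwards [eventually_ge_atTop r] with t ht
    have key := image_norm_le_of_norm_deriv_right_le_deriv_boundary' (f := fun x => f x - f r)
      (f' := f') (a := r) (b := t) (B := fun x => -ε * (x ^ α - r ^ α))
      (B' := fun x => -ε * (α * x ^ (α - 1)))
      (fun x hx => ((hr₀ x (hr.trans hx.1)).1.sub_const _).continuousAt.continuousWithinAt)
      (fun x hx => ((hr₀ x (hr.trans hx.1)).1.sub_const _).hasDerivWithinAt) (by simp)
      (fun x hx => (((Real.hasDerivAt_rpow_const (Or.inl (hpos.trans_le hx.1).ne')).sub_const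
        _).const_mul _).continuousAt.continuousWithinAt)
      (fun x hx => (((Real.hasDerivAt_rpow_const (Or.inl (hpos.trans_le hx.1).ne')).sub_const
        _).const_mul _).hasDerivWithinAt)
      (fun x hx => by
        have h1 := (hr₀ x (hr.trans hx.1)).2.1
        rw [Real.norm_of_nonneg (Real.rpow_nonneg (hpos.trans_le hx.1).le _)] at h1
        linarith) (right_mem_Icc.2 ht)
    have : 0 ≤ ε * t ^ α := mul_nonneg hε.le (Real.rpow_nonneg (hpos.le.trans ht) _)
    linarith
  have := le_of_tendsto (h0.sub_const (f r)).norm key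
  rwa [zero_sub, norm_neg, ← Real.norm_of_nonneg (Real.rpow_nonneg hpos.le α)] at this

end Asymptotics

/-! ### Dominant and recessive branches at infinity -/

namespace IsProfileSolution

variable {M a κ s c : ℝ} {u v : ℝ → ℂ}

lemma isLittleO_deriv {q : ℝ} (hv : (fun r : ℝ => (r : ℂ) * v r) =o[atTop] fun r : ℝ => r ^ q) :
    v =o[atTop] fun r : ℝ => r ^ (q - 1) := by
  refine (mul_isLittleO_rpow (ofReal_rpow_isBigO (-1)) hv
    (show -1 + q ≤ q - 1 by linarith)).congr' ?_ EventuallyEq.rfl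
  filter_upwards [eventually_gt_atTop 0] with r hr
  have : (r : ℂ) ≠ 0 := by exact_mod_cast hr.ne'
  rw [Real.rpow_neg_one]
  push_cast
  field_simp

lemma isLittleO_deriv_deriv (hM : 0 < M) {q : ℝ} (hu : u =o[atTop] fun r : ℝ => r ^ q)
    (hv : (fun r : ℝ => (r : ℂ) * v r) =o[atTop] fun r : ℝ => r ^ q) :
    (fun r : ℝ => (c * u r - ((1 - s) * (2 * (r - M)) + 2 * κ * Complex.I) * v r) / Delta M a r)
      =o[atTop] fun r : ℝ => r ^ (q - 2) := by
  have hb := mul_isLittleO_rpow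
    (linear_isBigO ((1 - s) * 2 : ℂ) (-(1 - s) * 2 * M + 2 * κ * Complex.I))
    (isLittleO_deriv hv) (show 1 + (q - 1) ≤ q by linarith)
  refine (mul_isLittleO_rpow (Delta_inv_isBigO M a hM) ((hu.const_mul_left (c : ℂ)).sub hb)
    (show -2 + q ≤ q - 2 by linarith)).congr_left fun r => ?_
  rw [div_eq_inv_mul]
  ring

/-- A solution that is not larger than the dominant branch `r ^ pp` at infinity decays up to one
power better, unless this beats the recessive branch `r ^ pm`. -/
lemma isLittleO_improve (h : IsProfileSolution M a κ s c u v) (hM : 0 < M)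
    {pp pm q q' : ℝ} (hadd : pp + pm = 2 * s - 1) (hmul : pp * pm = -c)
    (hu : u =o[atTop] fun r : ℝ => r ^ q)
    (hv : (fun r : ℝ => (r : ℂ) * v r) =o[atTop] fun r : ℝ => r ^ q)
    (hq : q ≤ pp) (hq' : q - 1 ≤ q') (hpp : q' < pp) (hpm : pm < q') :
    u =o[atTop] (fun r : ℝ => r ^ q') ∧
      (fun r : ℝ => (r : ℂ) * v r) =o[atTop] fun r : ℝ => r ^ q' := by
  have hw := isLittleO_deriv_deriv (s := s) (c := c) (κ := κ) (a := a) hM hu hv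
  set w : ℝ → ℂ :=
    fun r => (c * u r - ((1 - s) * (2 * (r - M)) + 2 * κ * Complex.I) * v r) / Delta M a r
  -- With `θ = r d/dr` the equation factors as `(θ - pp) (θ - pm) u = g`, where `g` gathers the
  -- terms one power of `r` below the Euler part. Below, `y = (θ - pm) u`.
  set g : ℝ → ℂ := fun r => (2 * M * r + -a ^ 2) * w r
    + (2 * (1 - s) * M - 2 * κ * Complex.I) * v r
  have hg : g =o[atTop] fun r : ℝ => r ^ (q - 1) :=
    (mul_isLittleO_rpow (linear_isBigO _ _) hw (by linarith)).add
      ((isLittleO_deriv hv).const_mul_left _)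
  set y : ℝ → ℂ := fun r => r * v r - pm * u r
  have hy : y =o[atTop] fun r : ℝ => r ^ q := hv.sub (hu.const_mul_left _)
  have haddC : (pp : ℂ) + pm = 2 * s - 1 := by exact_mod_cast hadd
  have hmulC : (pp : ℂ) * pm = -c := by exact_mod_cast hmul
  have hexp : ∀ p r : ℝ, 0 < r → ((r ^ p : ℝ) : ℂ) = ((r ^ (p - 1) : ℝ) : ℂ) * r := by
    intro p r hr
    rw [← Complex.ofReal_mul, ← Real.rpow_add_one hr.ne']
    simp
  have hev : ∀ᶠ r in atTop, rPlus M a < r ∧ 0 < Delta M a r ∧ 0 < r := by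
    filter_upwards [eventually_gt_atTop (4 * M), eventually_gt_atTop (rPlus M a)] with r hr hr'
    refine ⟨hr', ?_, by linarith⟩
    unfold Delta; nlinarith [sq_nonneg a]
  have hpow : ∀ p r : ℝ, 0 < r →
      HasDerivAt (fun ρ : ℝ => ((ρ ^ p : ℝ) : ℂ)) (p * (r ^ (p - 1) : ℝ)) r := by
    intro p r hr
    have := (Real.hasDerivAt_rpow_const (x := r) (p := p) (Or.inl hr.ne')).ofReal_comp
    push_cast at this ⊢
    exact this
  -- The factor `θ - pp` is integrated inward from infinity: `q ≤ pp` makes `r ^ (-pp) y` tend to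
  -- zero, which excludes the dominant branch.
  have hY : (fun r : ℝ => ((r ^ (-pp) : ℝ) : ℂ) * y r) =o[atTop] fun r : ℝ => r ^ (q' - pp) := by
    refine isLittleO_rpow_of_deriv_of_neg (by linarith)
      (f' := fun r => ((r ^ (-pp - 1) : ℝ) : ℂ) * g r) ?_
      (mul_isLittleO_rpow (ofReal_rpow_isBigO _) hg (by linarith)) ?_
    · filter_upwards [hev] with r hr
      have hy' : HasDerivAt y (1 * v r + r * w r - pm * v r) r :=
        ((((hasDerivAt_id r).ofReal_comp).mul (h.snd r hr.1)).sub
          ((h.fst r hr.1).const_mul (pm : ℂ)))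
      refine ((hpow (-pp) r hr.2.2).mul hy').congr_deriv ?_
      have hD : (Delta M a r : ℂ) ≠ 0 := by exact_mod_cast hr.2.1.ne'
      have hode : (Delta M a r : ℂ) * w r =
          c * u r - ((1 - s) * (2 * (r - M)) + 2 * κ * Complex.I) * v r := by
        simp only [w]; field_simp
      have hDr : (Delta M a r : ℂ) = r ^ 2 - 2 * M * r + a ^ 2 := by
        unfold Delta; push_cast; ring
      rw [hDr] at hode
      rw [hexp (-pp) r hr.2.2]
      simp only [g, y]
      push_cast
      linear_combination ((r ^ (-pp - 1) : ℝ) : ℂ) * (hode + u r * hmulC - r * v r * haddC)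
    · have := mul_isLittleO_rpow (t := 0) (ofReal_rpow_isBigO (-pp)) hy (by linarith)
      simpa only [Real.rpow_zero, isLittleO_one_iff] using this
  have hback : ∀ p : ℝ, ∀ f : ℝ → ℂ,
      (fun r : ℝ => ((r ^ (-p) : ℝ) : ℂ) * f r) =o[atTop] (fun r : ℝ => r ^ (q' - p)) →
      f =o[atTop] fun r : ℝ => r ^ q' := by
    intro p f hf
    refine (mul_isLittleO_rpow (ofReal_rpow_isBigO p) hf (show p + (q' - p) ≤ q' by linarith)).congr'
      ?_ EventuallyEq.rfl
    filter_upwards [eventually_gt_atTop 0] with r hr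
    rw [← mul_assoc, ← Complex.ofReal_mul, ← Real.rpow_add hr]
    simp
  have hy' := hback _ _ hY
  -- The factor `θ - pm` is integrated outward from a finite radius; the constant of integration is
  -- harmless because `q' > pm`.
  have hU : (fun r : ℝ => ((r ^ (-pm) : ℝ) : ℂ) * u r) =o[atTop] fun r : ℝ => r ^ (q' - pm) := by
    refine isLittleO_rpow_of_deriv_of_pos (by linarith)
      (f' := fun r => ((r ^ (-pm - 1) : ℝ) : ℂ) * y r) ?_
      (mul_isLittleO_rpow (ofReal_rpow_isBigO _) hy' (by linarith))
    filter_upwards [hev] with r hr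
    refine ((hpow (-pm) r hr.2.2).mul (h.fst r hr.1)).congr_deriv ?_
    rw [hexp (-pm) r hr.2.2]
    simp only [y]
    push_cast
    ring
  have hu' := hback _ _ hU
  refine ⟨hu', (hy'.add (hu'.const_mul_left (pm : ℂ))).congr_left fun r => ?_⟩
  simp only [y]
  ring

/-- Raising costs one power of `r`: the factor `Δ` costs two, of which `u'` gives one back. -/
lemma isLittleO_raised (hM : 0 < M) {q : ℝ} (hu : u =o[atTop] fun r : ℝ => r ^ q)
    (hv : (fun r : ℝ => (r : ℂ) * v r) =o[atTop] fun r : ℝ => r ^ q) :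
    raised M a κ s u v =o[atTop] (fun r : ℝ => r ^ (q + 1)) ∧
      (fun r : ℝ => (r : ℂ) * ((c - 2 * s) * u r)) =o[atTop] fun r : ℝ => r ^ (q + 1) := by
  constructor
  · refine ((mul_isLittleO_rpow (Delta_isBigO M a hM) (isLittleO_deriv hv)
      (show 2 + (q - 1) ≤ q + 1 by linarith)).add
      (mul_isLittleO_rpow (linear_isBigO (-s * 2 : ℂ) (s * 2 * M + 2 * κ * Complex.I)) hu
      (show 1 + q ≤ q + 1 by linarith))).congr_left fun r => ?_
    unfold raised
    ring
  · exact mul_isLittleO_rpow ofReal_isBigO (hu.const_mul_left _) (by linarith)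

end IsProfileSolution

/-! ### Limits at the horizon and at infinity -/

section Limits

lemma tendsto_nhdsGT_of_hasDerivAt {f f' : ℝ → ℂ} {a b : ℝ} (hab : a < b)
    (hf : ∀ x, a < x → HasDerivAt f (f' x) x) (hint : IntegrableOn f' (Ioo a b)) :
    ∃ L, Tendsto f (𝓝[>] a) (𝓝 L) := by
  have hI : IntegrableOn f' (uIcc a b) := by
    rw [uIcc_of_le hab.le]
    exact (integrableOn_Icc_iff_integrableOn_Ioo).2 hint
  have hc := intervalIntegral.continuousOn_primitive_interval_left hI
  have h1 : Tendsto (fun x => ∫ t in x..b, f' t) (𝓝[>] a) (𝓝 (∫ t in a..b, f' t)) := by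
    refine (hc a left_mem_uIcc).tendsto.mono_left ?_
    rw [uIcc_of_le hab.le, ← nhdsWithin_Ioo_eq_nhdsGT hab]
    exact nhdsWithin_mono _ Ioo_subset_Icc_self
  refine ⟨f b - ∫ t in a..b, f' t, (h1.const_sub (f b)).congr' ?_⟩
  filter_upwards [Ioo_mem_nhdsGT hab] with x hx
  rw [intervalIntegral.integral_eq_sub_of_hasDerivAt (f := f), sub_sub_cancel]
  · intro y hy
    rw [uIcc_of_le hx.2.le] at hy
    exact hf y (hx.1.trans_le hy.1)
  · refine (intervalIntegrable_iff_integrableOn_Ioo_of_le hx.2.le).2 (hint.mono_set ?_)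
    exact Ioo_subset_Ioo_left hx.1.le

lemma integrableOn_of_integrableOn_sq {f : ℝ → ℂ} {a b : ℝ} (hc : ContinuousOn f (Ioo a b))
    (h : IntegrableOn (fun x => ‖f x‖ ^ 2) (Ioo a b)) : IntegrableOn f (Ioo a b) := by
  have h1 : IntegrableOn (fun _ : ℝ => (1 : ℝ)) (Ioo a b) := by simp
  refine (h1.add h).mono' (hc.aestronglyMeasurable measurableSet_Ioo)
    (Eventually.of_forall fun x => ?_)
  simp only [Pi.add_apply]
  nlinarith [sq_nonneg (‖f x‖ - 1), norm_nonneg (f x)]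

/-- `1 / Δ` is not integrable at the horizon. -/
lemma nonpos_of_tendsto_Delta_mul {M a b L : ℝ} {g : ℝ → ℝ} (ha : |a| ≤ M)
    (hb : rPlus M a < b) (hg : IntegrableOn g (Ioo (rPlus M a) b))
    (hL : Tendsto (fun r => Delta M a r * g r) (𝓝[>] rPlus M a) (𝓝 L)) : L ≤ 0 := by
  by_contra! hpos
  have hev := hL.eventually_const_lt (show L / 2 < L by linarith)
  obtain ⟨d, hd, hdm⟩ := (mem_nhdsGT_iff_exists_Ioo_subset' hb).1 hev
  set e := min d (min b (rPlus M a + 1)) with he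
  have hpe : rPlus M a < e := lt_min hd (lt_min hb (by linarith))
  have hed : e ≤ d := min_le_left _ _
  have heb : e ≤ b := (min_le_right _ _).trans (min_le_left _ _)
  have he1 : e ≤ rPlus M a + 1 := (min_le_right _ _).trans (min_le_right _ _)
  -- Within distance one of the horizon `Δ ≤ C (r - r₊)`, the extremal case included, so a positive
  -- limit would make `g` dominate a multiple of `1 / (r - r₊)`.
  set C := 2 * √(M ^ 2 - a ^ 2) + 1 with hC
  have hC0 : 0 < C := by positivity
  have hint : IntegrableOn (fun r => (r - rPlus M a)⁻¹) (Ioo (rPlus M a) e) := by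
    refine (((hg.mono_set (Ioo_subset_Ioo_right heb)).const_mul (2 * C / L))).mono'
      (by fun_prop) ?_
    filter_upwards [ae_restrict_mem measurableSet_Ioo] with r hr
    have h1 : L / 2 < Delta M a r * g r := hdm ⟨hr.1, hr.2.trans_le hed⟩
    have hx : 0 < r - rPlus M a := sub_pos.2 hr.1
    have hD : Delta M a r ≤ C * (r - rPlus M a) := by
      rw [Delta_eq_mul M a r ha, mul_comm]
      refine mul_le_mul_of_nonneg_right ?_ hx.le
      have := hr.2
      unfold rPlus at he1
      linarith
    have hDp := Delta_pos ha hr.1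
    have hg0 : 0 < g r := by
      by_contra! hneg
      nlinarith
    rw [Real.norm_of_nonneg (by positivity), inv_le_iff_one_le_mul₀ hx]
    have h2 : Delta M a r * g r ≤ C * (r - rPlus M a) * g r := by gcongr
    have h3 : 2 * C / L * g r * (r - rPlus M a) = (2 / L) * (C * (r - rPlus M a) * g r) := by ring
    rw [h3]
    calc (1 : ℝ) = 2 / L * (L / 2) := by field_simp
      _ ≤ _ := by gcongr; linarith
  have := (intervalIntegrable_iff_integrableOn_Ioo_of_le hpe.le).2 hint
  rw [intervalIntegrable_sub_inv_iff] at this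
  rcases this with h | h
  · exact hpe.ne h
  · exact h left_mem_uIcc

lemma eq_of_hasDerivAt_zero {f : ℝ → ℂ} {a : ℝ} (hf : ∀ x, a < x → HasDerivAt f 0 x) {x y : ℝ}
    (hx : a < x) (hxy : x ≤ y) : f y = f x := by
  refine constant_of_derivWithin_zero (a := x) (b := y)
    (fun z hz => (hf z (hx.trans_le hz.1)).differentiableAt.differentiableWithinAt)
    (fun z hz => ?_) y ⟨hxy, le_rfl⟩
  exact (hf z (hx.trans_le hz.1)).hasDerivWithinAt.derivWithin
    (uniqueDiffOn_Icc (hz.1.trans_lt hz.2) z ⟨hz.1, hz.2.le⟩)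

lemma eq_zero_of_hasDerivAt_zero {f : ℝ → ℂ} {a : ℝ} (hf : ∀ x, a < x → HasDerivAt f 0 x)
    (h0 : Tendsto f atTop (𝓝 0)) {x : ℝ} (hx : a < x) : f x = 0 := by
  refine tendsto_nhds_unique (tendsto_const_nhds.congr' ?_) h0
  filter_upwards [eventually_ge_atTop x] with y hy using (eq_of_hasDerivAt_zero hf hx hy).symm

lemma isLittleO_star {f : ℝ → ℂ} {q : ℝ} (hf : f =o[atTop] fun r : ℝ => r ^ q) :
    (fun r => star (f r)) =o[atTop] fun r : ℝ => r ^ q :=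
  (hf.norm_left.congr_left fun _ => (norm_star _).symm).of_norm_left

end Limits

/-! ### Vanishing at the horizon and the base spins `0` and `1/2` -/

namespace IsProfileSolution

variable {M a κ s c : ℝ} {u v : ℝ → ℂ}

/-- Both `u` and its raised function have integrable derivatives near the horizon, hence limits, and
so does `Δ u'`. A nonzero limit of `Δ u'` would make `|u'|` comparable to `1 / Δ`, which is not
integrable. -/
lemma tendsto_horizon (h : IsProfileSolution M a κ s c u v) (ha : |a| ≤ M) {b : ℝ}
    (hb : rPlus M a < b) (hu : IntegrableOn (fun r => ‖u r‖ ^ 2) (Ioo (rPlus M a) b))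
    (hv : IntegrableOn (fun r => ‖v r‖ ^ 2) (Ioo (rPlus M a) b)) :
    (∃ U, Tendsto u (𝓝[>] rPlus M a) (𝓝 U)) ∧
      Tendsto (fun r : ℝ => Delta M a r * v r) (𝓝[>] rPlus M a) (𝓝 0) := by
  have hui := integrableOn_of_integrableOn_sq
    (fun r hr => (h.fst r hr.1).continuousAt.continuousWithinAt) hu
  have hvi := integrableOn_of_integrableOn_sq
    (fun r hr => (h.snd r hr.1).continuousAt.continuousWithinAt) hv
  obtain ⟨U, hU⟩ := tendsto_nhdsGT_of_hasDerivAt hb h.fst hvi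
  obtain ⟨Φ, hΦ⟩ := tendsto_nhdsGT_of_hasDerivAt hb (fun r hr => h.hasDerivAt_raised ha hr)
    (hui.const_mul _)
  refine ⟨⟨U, hU⟩, ?_⟩
  have hlin : Tendsto (fun r : ℝ => (-s * (2 * (r - M)) + 2 * κ * Complex.I : ℂ))
      (𝓝[>] rPlus M a) (𝓝 (-s * (2 * (rPlus M a - M)) + 2 * κ * Complex.I : ℂ)) :=
    (Continuous.tendsto (by fun_prop) _).mono_left nhdsWithin_le_nhds
  have hlim := (hΦ.sub (hlin.mul hU)).congr
    (f₂ := fun r : ℝ => (Delta M a r * v r : ℂ)) (fun r => by unfold raised; ring)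
  have hL := nonpos_of_tendsto_Delta_mul ha hb hvi.norm
    ((hlim.norm).congr' (by
      filter_upwards [self_mem_nhdsWithin] with r hr
      rw [norm_mul, Complex.norm_real, Real.norm_of_nonneg (Delta_pos ha hr).le]))
  rwa [norm_le_zero_iff.1 hL] at hlim

/-- A solution that vanishes at the horizon and is controlled there by its raised function
vanishes identically. -/
lemma eq_zero_of_tendsto_horizon (h : IsProfileSolution M a κ s c u v) (ha : |a| ≤ M)
    (hu : Tendsto u (𝓝[>] rPlus M a) (𝓝 0))
    (hv : Tendsto (fun r : ℝ => Delta M a r * v r) (𝓝[>] rPlus M a) (𝓝 0)) {C : ℝ} (hC : 0 ≤ C)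
    (hle : ∀ᶠ r in 𝓝[>] rPlus M a, ‖u r‖ ≤ C * ‖raised M a κ s u v r‖) {r : ℝ}
    (hr : rPlus M a < r) : u r = 0 := by
  set p := rPlus M a
  have hΦ : Tendsto (raised M a κ s u v) (𝓝[>] p) (𝓝 0) := by
    have hlin : Tendsto (fun r : ℝ => (-s * (2 * (r - M)) + 2 * κ * Complex.I : ℂ))
        (𝓝[>] p) (𝓝 (-s * (2 * (p - M)) + 2 * κ * Complex.I : ℂ)) :=
      (Continuous.tendsto (by fun_prop) _).mono_left nhdsWithin_le_nhds
    have := hv.add (hlin.mul hu)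
    rw [mul_zero, add_zero] at this
    exact this
  have hbd : ∀ᶠ r in 𝓝[>] p, ‖u r‖ ≤ 1 := by
    have := hu.norm
    rw [norm_zero] at this
    exact this.eventually_le_const zero_lt_one
  set l := ‖(c - 2 * s : ℂ)‖
  have hsmall : ∀ᶠ r in 𝓝[>] p, C * l * (r - p) ≤ 1 / 2 := by
    have : Tendsto (fun r : ℝ => C * l * (r - p)) (𝓝[>] p) (𝓝 (C * l * (p - p))) :=
      (Continuous.tendsto (by fun_prop) _).mono_left nhdsWithin_le_nhds
    rw [sub_self, mul_zero] at this
    exact this.eventually_le_const (by norm_num)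
  obtain ⟨d, hd, hdm⟩ := (mem_nhdsGT_iff_exists_Ioo_subset' (lt_add_one p)).1
    ((hle.and hbd).and hsmall)
  have hd : p < d := hd
  -- The raised function starts from `0` at the horizon with slope at most `l B`; the choice of `d`
  -- turns the resulting bound on `u` into half of `B`.
  have hstep : ∀ B : ℝ, 0 ≤ B → (∀ x ∈ Ioo p d, ‖u x‖ ≤ B) → ∀ x ∈ Ioo p d, ‖u x‖ ≤ B / 2 := by
    intro B hB hbound x hx
    have hmv : ∀ᶠ t in 𝓝[>] p,
        ‖raised M a κ s u v x - raised M a κ s u v t‖ ≤ l * B * (x - p) := by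
      filter_upwards [Ioo_mem_nhdsGT hx.1] with t ht
      have := (convex_Icc t x).norm_image_sub_le_of_norm_hasDerivWithin_le
        (f := raised M a κ s u v) (C := l * B)
        (fun y hy => (h.hasDerivAt_raised ha (ht.1.trans_le hy.1)).hasDerivWithinAt)
        (fun y hy => by
          rw [norm_mul]
          gcongr
          exact hbound y ⟨ht.1.trans_le hy.1, hy.2.trans_lt hx.2⟩)
        (left_mem_Icc.2 ht.2.le) (right_mem_Icc.2 ht.2.le)
      refine this.trans ?_
      rw [Real.norm_of_nonneg (by linarith [ht.2])]
      gcongr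
      exact ht.1.le
    have hx2 := le_of_tendsto (hΦ.const_sub _).norm hmv
    rw [sub_zero] at hx2
    have hdx := hdm hx
    calc ‖u x‖ ≤ C * ‖raised M a κ s u v x‖ := hdx.1.1
      _ ≤ C * (l * B * (x - p)) := by gcongr
      _ = C * l * (x - p) * B := by ring
      _ ≤ 1 / 2 * B := by gcongr; exact hdx.2
      _ = B / 2 := by ring
  have hiter : ∀ n : ℕ, ∀ x ∈ Ioo p d, ‖u x‖ ≤ (1 / 2 : ℝ) ^ n := by
    intro n
    induction n with
    | zero => intro x hx; simpa using (hdm hx).1.2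
    | succ n ih =>
      intro x hx
      have := hstep _ (by positivity) ih x hx
      rw [pow_succ]
      linarith
  have hzero : ∀ x ∈ Ioo p d, u x = 0 := by
    intro x hx
    have := ge_of_tendsto' (tendsto_pow_atTop_nhds_zero_of_lt_one (r := (1 / 2 : ℝ)) (by norm_num)
      (by norm_num)) fun n => hiter n x hx
    exact norm_le_zero_iff.1 this
  by_cases hrd : r < d
  · exact hzero r ⟨hr, hrd⟩
  · obtain ⟨x, hx⟩ := exists_between hd
    have hvx : v x = 0 := by
      refine (h.fst x hx.1).unique ((hasDerivAt_const x (0 : ℂ)).congr_of_eventuallyEq ?_)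
      filter_upwards [Ioo_mem_nhds hx.1 hx.2] with y hy using hzero y hy
    exact h.eq_zero_of_eq_zero ha hx.1 (hzero x hx) hvx (hx.2.le.trans (not_lt.1 hrd))

/-- Spin zero: conservation of the flux `Im (Δ u' ū) + κ |u|²`. -/
lemma eq_zero_of_spin_zero (h : IsProfileSolution M a κ 0 c u v) (hM : 0 < M) (ha : |a| ≤ M)
    (hκ : κ ≠ 0) {b : ℝ} (hb : rPlus M a < b)
    (hu : IntegrableOn (fun r => ‖u r‖ ^ 2) (Ioo (rPlus M a) b))
    (hv : IntegrableOn (fun r => ‖v r‖ ^ 2) (Ioo (rPlus M a) b))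
    (hu' : u =o[atTop] fun r : ℝ => r ^ (-(1 / 2) : ℝ))
    (hv' : (fun r : ℝ => (r : ℂ) * v r) =o[atTop] fun r : ℝ => r ^ (-(1 / 2) : ℝ))
    {r : ℝ} (hr : rPlus M a < r) : u r = 0 := by
  have hflux : ∀ r, rPlus M a < r → Delta M a r * (v r * star (u r) - star (v r) * u r)
      + 2 * κ * Complex.I * (u r * star (u r)) = 0 := by
    intro r hr
    refine eq_zero_of_hasDerivAt_zero (f := fun r : ℝ => Delta M a r *
      (v r * star (u r) - star (v r) * u r) + 2 * κ * Complex.I * (u r * star (u r)))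
      (fun x hx => ?_) ?_ hr
    · have hD : (Delta M a x : ℂ) ≠ 0 := by exact_mod_cast (Delta_pos ha hx).ne'
      have h1 := h.fst x hx
      have h2 := h.snd x hx
      refine (((hasDerivAt_Delta_ofReal M a x).mul ((h2.mul h1.star).sub (h2.star.mul h1))).add
        ((h1.mul h1.star).const_mul (2 * κ * Complex.I : ℂ))).congr_deriv ?_
      simp only [Complex.star_def, map_div₀, map_sub, map_mul, map_add, Complex.conj_ofReal,
        Complex.conj_I, map_one, map_ofNat, Pi.sub_apply, Pi.mul_apply, Complex.ofReal_zero,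
        map_zero]
      field_simp
      ring
    · have hvd := isLittleO_deriv hv'
      have h1 := mul_isLittleO_rpow (Delta_isBigO M a hM)
        (((mul_isLittleO_rpow hvd.isBigO (isLittleO_star hu') (t := -2) (by norm_num))).sub
          (mul_isLittleO_rpow (isLittleO_star hvd).isBigO hu' (t := -2) (by norm_num)))
        (t := 0) (by norm_num)
      have h2 := (mul_isLittleO_rpow hu'.isBigO (isLittleO_star hu') (t := 0)
        (by norm_num)).const_mul_left (2 * κ * Complex.I : ℂ)
      simpa only [Real.rpow_zero, isLittleO_one_iff] using h1.add h2
  have hbound : ∀ r, rPlus M a < r → |κ| * ‖u r‖ ^ 2 ≤ ‖raised M a κ 0 u v r‖ * ‖u r‖ := by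
    intro r hr
    -- The raised function contributes `2 κ |u|²`, of which zero flux cancels exactly one half.
    have h1 : (raised M a κ 0 u v r * star (u r)).im = κ * ‖u r‖ ^ 2 := by
      have h2 := congrArg Complex.im (hflux r hr)
      rw [← Complex.normSq_eq_norm_sq, Complex.normSq_apply]
      simp [raised] at h2 ⊢
      linarith
    calc |κ| * ‖u r‖ ^ 2 = |(raised M a κ 0 u v r * star (u r)).im| := by
          rw [h1, abs_mul, abs_of_nonneg (sq_nonneg ‖u r‖)]
      _ ≤ ‖raised M a κ 0 u v r * star (u r)‖ := Complex.abs_im_le_norm _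
      _ = _ := by rw [norm_mul, norm_star]
  have hκ' : 0 < |κ| := abs_pos.2 hκ
  obtain ⟨⟨U, hU⟩, hv0⟩ := h.tendsto_horizon ha hb hu hv
  have hU0 : U = 0 := by
    have hlim : Tendsto (fun r : ℝ => Delta M a r * (v r) * star (u r) -
        star (Delta M a r * v r) * u r + 2 * κ * Complex.I * (u r * star (u r)))
        (𝓝[>] rPlus M a) (𝓝 (0 * star U - star 0 * U + 2 * κ * Complex.I * (U * star U))) :=
      ((hv0.mul hU.star).sub (hv0.star.mul hU)).add ((hU.mul hU.star).const_mul _)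
    have h0 := tendsto_nhds_unique hlim (tendsto_const_nhds.congr' (by
      filter_upwards [self_mem_nhdsWithin] with r hr
      refine (hflux r hr).symm.trans ?_
      simp only [Complex.star_def, map_mul, Complex.conj_ofReal]
      ring))
    simpa [hκ] using h0
  rw [hU0] at hU
  refine h.eq_zero_of_tendsto_horizon ha hU hv0 (C := |κ|⁻¹) (by positivity) ?_ hr
  filter_upwards [self_mem_nhdsWithin] with r hr
  have := hbound r hr
  rw [inv_mul_eq_div, le_div_iff₀ hκ']
  rcases (norm_nonneg (u r)).eq_or_lt with h0 | h0
  · rw [← h0, zero_mul]; positivity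
  · nlinarith

/-- Spin one half: conservation of `Δ |u'|² - c |u|²`. -/
lemma eq_zero_of_spin_half (h : IsProfileSolution M a κ (1 / 2) c u v) (hM : 0 < M) (ha : |a| ≤ M)
    (hκ : κ ≠ 0) {b : ℝ} (hb : rPlus M a < b)
    (hu : IntegrableOn (fun r => ‖u r‖ ^ 2) (Ioo (rPlus M a) b))
    (hv : IntegrableOn (fun r => ‖v r‖ ^ 2) (Ioo (rPlus M a) b))
    (hu' : u =o[atTop] fun r : ℝ => r ^ (0 : ℝ))
    (hv' : (fun r : ℝ => (r : ℂ) * v r) =o[atTop] fun r : ℝ => r ^ (0 : ℝ))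
    {r : ℝ} (hr : rPlus M a < r) : u r = 0 := by
  have hcons : ∀ r, rPlus M a < r → Delta M a r * ‖v r‖ ^ 2 = c * ‖u r‖ ^ 2 := by
    intro r hr
    have : Delta M a r * (v r * star (v r)) - c * (u r * star (u r)) = 0 := by
      refine eq_zero_of_hasDerivAt_zero (f := fun r : ℝ => Delta M a r *
        (v r * star (v r)) - c * (u r * star (u r))) (fun x hx => ?_) ?_ hr
      · have hD : (Delta M a x : ℂ) ≠ 0 := by exact_mod_cast (Delta_pos ha hx).ne'
        have h1 := h.fst x hx
        have h2 := h.snd x hx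
        refine (((hasDerivAt_Delta_ofReal M a x).mul (h2.mul h2.star)).sub
          ((h1.mul h1.star).const_mul (c : ℂ))).congr_deriv ?_
        simp only [Complex.star_def, map_div₀, map_sub, map_mul, map_add, Complex.conj_ofReal,
          Complex.conj_I, map_one, map_ofNat, Pi.mul_apply]
        push_cast
        field_simp
        ring
      · have hvd := isLittleO_deriv hv'
        have h1 := mul_isLittleO_rpow (Delta_isBigO M a hM)
          (mul_isLittleO_rpow hvd.isBigO (isLittleO_star hvd) (t := -2) (by norm_num))
          (t := 0) (by norm_num)
        have h2 := (mul_isLittleO_rpow hu'.isBigO (isLittleO_star hu') (t := 0)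
          (by norm_num)).const_mul_left (c : ℂ)
        simpa only [Real.rpow_zero, isLittleO_one_iff] using h1.sub h2
    simp only [Complex.star_def, Complex.mul_conj, Complex.normSq_eq_norm_sq] at this
    have h3 : Delta M a r * ‖v r‖ ^ 2 - c * ‖u r‖ ^ 2 = 0 := by exact_mod_cast this
    linarith
  rcases lt_trichotomy c 0 with hc | hc | hc
  · have h1 := hcons r hr
    have h2 := mul_nonneg (Delta_pos ha hr).le (sq_nonneg ‖v r‖)
    have h3 : ‖u r‖ ^ 2 = 0 := le_antisymm (by nlinarith) (sq_nonneg _)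
    simpa using h3
  · refine eq_zero_of_hasDerivAt_zero (f := u) (fun x hx => ?_) ?_ hr
    · have h1 := hcons x hx
      rw [hc, zero_mul, mul_eq_zero, or_iff_right (Delta_pos ha hx).ne'] at h1
      have h2 : v x = 0 := by simpa using h1
      simpa only [h2] using h.fst x hx
    · simpa only [Real.rpow_zero, isLittleO_one_iff] using hu'
  · obtain ⟨⟨U, hU⟩, hv0⟩ := h.tendsto_horizon ha hb hu hv
    have hU0 : U = 0 := by
      -- By the conservation law `Δ |u'|²` tends to `c |U|²`, and `|u'|²` is integrable, so this
      -- limit cannot be positive.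
      have hL := nonpos_of_tendsto_Delta_mul ha hb hv (L := c * ‖U‖ ^ 2)
        (((hU.norm.pow 2).const_mul c).congr' (by
          filter_upwards [self_mem_nhdsWithin] with r hr
          exact (hcons r hr).symm))
      have h3 : ‖U‖ ^ 2 = 0 := le_antisymm (by nlinarith) (sq_nonneg _)
      simpa using h3
    rw [hU0] at hU
    have hκ' : 0 < |κ| := abs_pos.2 hκ
    refine h.eq_zero_of_tendsto_horizon ha hU hv0 (C := |κ|⁻¹) (by positivity) ?_ hr
    have hsmall : ∀ᶠ r in 𝓝[>] rPlus M a, c * Delta M a r ≤ |κ| ^ 2 := by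
      have : Tendsto (fun r => c * Delta M a r) (𝓝[>] rPlus M a) (𝓝 (c * Delta M a (rPlus M a))) :=
        ((((continuous_Delta M a).tendsto _).const_mul c).mono_left nhdsWithin_le_nhds)
      rw [Delta_rPlus M a ha, mul_zero] at this
      exact this.eventually_le_const (by positivity)
    filter_upwards [self_mem_nhdsWithin, hsmall] with r hr hsm
    have hr : rPlus M a < r := hr
    have hD := Delta_pos ha hr
    rw [inv_mul_eq_div, le_div_iff₀ hκ']
    -- Near the horizon `Δ u'` is at most half of the lower bound `2 |κ| |u|` for the other term of
    -- the raised function, so it cannot cancel that term.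
    have h1 : ‖Delta M a r * v r‖ ≤ |κ| * ‖u r‖ := by
      refine le_of_sq_le_sq ?_ (by positivity)
      rw [norm_mul, Complex.norm_real, Real.norm_of_nonneg hD.le]
      calc (Delta M a r * ‖v r‖) ^ 2 = Delta M a r * (Delta M a r * ‖v r‖ ^ 2) := by ring
        _ = c * Delta M a r * ‖u r‖ ^ 2 := by rw [hcons r hr]; ring
        _ ≤ |κ| ^ 2 * ‖u r‖ ^ 2 := by gcongr
        _ = _ := by ring
    have h2 : 2 * |κ| * ‖u r‖ ≤
        ‖(-(1 / 2 : ℝ) * (2 * (r - M)) + 2 * κ * Complex.I : ℂ) * u r‖ := by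
      rw [norm_mul]
      gcongr
      calc 2 * |κ| = |(-(1 / 2 : ℝ) * (2 * (r - M)) + 2 * κ * Complex.I : ℂ).im| := by
            simp [abs_mul]
        _ ≤ _ := Complex.abs_im_le_norm _
    have h3 := norm_sub_le (raised M a κ (1 / 2) u v r) (Delta M a r * v r)
    rw [raised, add_sub_cancel_left, ← raised] at h3
    linarith

end IsProfileSolution

/-! ### From finite energy to pointwise decay -/

section Energy

/-- The derivative is integrable, so `g` has a limit; a positive one would make `e` dominate a
multiple of `1 / r`. -/
lemma tendsto_zero_of_abs_deriv_le {g g' e : ℝ → ℝ} {a K : ℝ} (he : IntegrableOn e (Ioi a))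
    (hg : ∀ᶠ r in atTop, HasDerivAt g (g' r) r) (hg' : ∀ᶠ r in atTop, |g' r| ≤ K * e r)
    (hg0 : ∀ᶠ r in atTop, 0 ≤ g r) (hge : ∀ᶠ r in atTop, g r ≤ r * e r) :
    Tendsto g atTop (𝓝 0) := by
  obtain ⟨b, hb⟩ := eventually_atTop.1 (((hg.and hg').and (hg0.and hge)).and
    ((eventually_gt_atTop a).and (eventually_gt_atTop 0)))
  have heb : ∀ d, b ≤ d → IntegrableOn e (Ioi d) := fun d hd =>
    he.mono_set (Ioi_subset_Ioi ((hb b le_rfl).2.1.le.trans hd))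
  have hint : IntegrableOn g' (Ioi b) := by
    refine ((heb b le_rfl).const_mul K).mono' ?_ ?_
    · refine (aestronglyMeasurable_deriv g _).congr ?_
      filter_upwards [ae_restrict_mem measurableSet_Ioi] with r hr
      exact (hb r (le_of_lt hr)).1.1.1.deriv
    · filter_upwards [ae_restrict_mem measurableSet_Ioi] with r hr
      exact (hb r (le_of_lt hr)).1.1.2
  have hlim := tendsto_limUnder_of_hasDerivAt_of_integrableOn_Ioi
    (fun r hr => (hb r (le_of_lt hr)).1.1.1) hint
  set L := limUnder atTop g
  have hL0 : 0 ≤ L := ge_of_tendsto hlim hg0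
  rcases hL0.eq_or_lt with hL | hL
  · rwa [← hL] at hlim
  · exfalso
    obtain ⟨d, hd⟩ := eventually_atTop.1
      ((hlim.eventually_const_lt (show L / 2 < L by linarith)).and (eventually_ge_atTop b))
    refine not_integrableOn_Ioi_inv (a := d) ?_
    refine ((heb d (hd d le_rfl).2).const_mul (2 / L)).mono' (by fun_prop) ?_
    filter_upwards [ae_restrict_mem measurableSet_Ioi] with r hr
    have hr' := hd r (le_of_lt hr)
    have hbr := hb r hr'.2
    have hr0 := hbr.2.2
    rw [Real.norm_of_nonneg (by positivity), inv_le_iff_one_le_mul₀ hr0]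
    calc (1 : ℝ) = 2 / L * (L / 2) := by field_simp
      _ ≤ 2 / L * (r * e r) := by gcongr; linarith [hr'.1, hbr.1.2.2]
      _ = _ := by ring

lemma isLittleO_of_tendsto_mul_sq {f : ℝ → ℂ}
    (h : Tendsto (fun r : ℝ => r * ‖f r‖ ^ 2) atTop (𝓝 0)) :
    f =o[atTop] fun r : ℝ => r ^ (-(1 / 2) : ℝ) := by
  rw [isLittleO_iff]
  intro ε hε
  filter_upwards [h.eventually_le_const (show 0 < ε ^ 2 by positivity), eventually_gt_atTop 0]
    with r hr hr0
  rw [Real.norm_of_nonneg (Real.rpow_nonneg hr0.le _)]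
  refine le_of_sq_le_sq ?_ (by positivity)
  rw [mul_pow, ← Real.rpow_natCast (r ^ (-(1 / 2) : ℝ)), ← Real.rpow_mul hr0.le]
  norm_num
  rw [Real.rpow_neg_one, ← div_eq_mul_inv, le_div_iff₀ hr0]
  linarith

namespace IsProfileSolution

variable {M a κ s c : ℝ} {u v : ℝ → ℂ}

/-- The preceding criterion is applied to `r |u|²` and `r³ |u'|²`. In the second, the equation
trades `u''` for `u` and `u'`, so the derivative is still controlled by the energy density. -/
lemma isLittleO_of_energy (h : IsProfileSolution M a κ s c u v) (hM : 0 < M)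
    (hE : IntegrableOn (fun r : ℝ => r ^ 2 * ‖v r‖ ^ 2 + ‖u r‖ ^ 2) (Ioi (rPlus M a))) :
    u =o[atTop] (fun r : ℝ => r ^ (-(1 / 2) : ℝ)) ∧
      (fun r : ℝ => (r : ℂ) * v r) =o[atTop] fun r : ℝ => r ^ (-(1 / 2) : ℝ) := by
  constructor
  · refine isLittleO_of_tendsto_mul_sq (tendsto_zero_of_abs_deriv_le (K := 2) hE
      (g' := fun r => 1 * ‖u r‖ ^ 2 + r * (2 * inner ℝ (u r) (v r))) ?_ ?_ ?_ ?_)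
    · filter_upwards [eventually_gt_atTop (rPlus M a)] with r hr
      exact (hasDerivAt_id r).mul (h.fst r hr).norm_sq
    · filter_upwards [eventually_gt_atTop 0] with r hr
      have h1 := abs_real_inner_le_norm (u r) (v r)
      rw [abs_le] at h1 ⊢
      have h2 := sq_nonneg (r * ‖v r‖ - ‖u r‖)
      have h3 := mul_le_mul_of_nonneg_left h1.1 hr.le
      have h4 := mul_le_mul_of_nonneg_left h1.2 hr.le
      constructor <;> nlinarith [sq_nonneg ‖u r‖, mul_nonneg (sq_nonneg r) (sq_nonneg ‖v r‖)]
    · filter_upwards [eventually_ge_atTop 0] with r hr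
      positivity
    · filter_upwards [eventually_ge_atTop 0] with r hr
      gcongr
      have : 0 ≤ r ^ 2 * ‖v r‖ ^ 2 := by positivity
      linarith
  · obtain ⟨A, hA0, hA⟩ := (Delta_inv_isBigO M a hM).exists_pos
    obtain ⟨B, hB0, hB⟩ := (linear_isBigO ((1 - s) * 2 : ℂ)
      (-(1 - s) * 2 * M + 2 * κ * Complex.I)).exists_pos
    set w : ℝ → ℂ :=
      fun r => (c * u r - ((1 - s) * (2 * (r - M)) + 2 * κ * Complex.I) * v r) / Delta M a r
    have hw : ∀ᶠ r in atTop, r ^ 2 * ‖w r‖ ≤ A * (|c| * ‖u r‖ + B * r * ‖v r‖) := by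
      filter_upwards [hA.bound, hB.bound, eventually_gt_atTop 0] with r h1 h2 hr
      rw [Real.rpow_neg hr.le, Real.rpow_two, Real.norm_of_nonneg (by positivity)] at h1
      rw [Real.rpow_one, Real.norm_of_nonneg hr.le] at h2
      have h3 : ‖(c * u r - ((1 - s) * (2 * (r - M)) + 2 * κ * Complex.I) * v r : ℂ)‖
          ≤ |c| * ‖u r‖ + B * r * ‖v r‖ := by
        refine (norm_sub_le _ _).trans ?_
        rw [norm_mul, norm_mul, Complex.norm_real, Real.norm_eq_abs]
        gcongr
        rw [show ((1 - s) * (2 * (r - M)) + 2 * κ * Complex.I : ℂ) =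
          (1 - s) * 2 * r + (-(1 - s) * 2 * M + 2 * κ * Complex.I) by ring]
        exact h2
      calc r ^ 2 * ‖w r‖ = r ^ 2 * (‖(Delta M a r : ℂ)⁻¹‖ *
            ‖(c * u r - ((1 - s) * (2 * (r - M)) + 2 * κ * Complex.I) * v r : ℂ)‖) := by
            rw [← norm_mul, inv_mul_eq_div]
        _ ≤ r ^ 2 * ((A * (r ^ 2)⁻¹) * (|c| * ‖u r‖ + B * r * ‖v r‖)) := by gcongr
        _ = _ := by field_simp
    have hlim : Tendsto (fun r : ℝ => r ^ 3 * ‖v r‖ ^ 2) atTop (𝓝 0) := by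
      refine tendsto_zero_of_abs_deriv_le (K := 3 + A * (|c| + 2 * B)) hE
        (g' := fun r => 3 * r ^ 2 * ‖v r‖ ^ 2 + r ^ 3 * (2 * inner ℝ (v r) (w r))) ?_ ?_ ?_ ?_
      · filter_upwards [eventually_gt_atTop (rPlus M a)] with r hr
        refine ((hasDerivAt_pow 3 r).mul (h.snd r hr).norm_sq).congr_deriv ?_
        norm_num [w]
      · filter_upwards [eventually_gt_atTop 0, hw] with r hr hwr
        have h1 := abs_real_inner_le_norm (v r) (w r)
        set x := r * ‖v r‖ with hx
        have hx0 : 0 ≤ x := by positivity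
        have h2 : |r ^ 3 * (2 * inner ℝ (v r) (w r))| ≤
            2 * x * (A * (|c| * ‖u r‖ + B * x)) := by
          rw [abs_mul, abs_mul, abs_of_pos (pow_pos hr 3), abs_two]
          calc r ^ 3 * (2 * |inner ℝ (v r) (w r)|) ≤ r ^ 3 * (2 * (‖v r‖ * ‖w r‖)) := by gcongr
            _ = 2 * x * (r ^ 2 * ‖w r‖) := by rw [hx]; ring
            _ ≤ 2 * x * (A * (|c| * ‖u r‖ + B * r * ‖v r‖)) := by gcongr
            _ = _ := by rw [hx]; ring
        have h3 : 2 * x * (A * (|c| * ‖u r‖ + B * x)) ≤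
            A * (|c| + 2 * B) * (x ^ 2 + ‖u r‖ ^ 2) := by
          have e1 : A * |c| * (2 * x * ‖u r‖) ≤ A * |c| * (x ^ 2 + ‖u r‖ ^ 2) := by
            gcongr
            linarith [two_mul_le_add_sq x ‖u r‖]
          have e2 : 0 ≤ A * (2 * B) * ‖u r‖ ^ 2 := by positivity
          linarith
        have h4 : 3 * r ^ 2 * ‖v r‖ ^ 2 = 3 * x ^ 2 := by rw [hx]; ring
        have h5 : r ^ 2 * ‖v r‖ ^ 2 = x ^ 2 := by rw [hx]; ring
        refine (abs_add_le _ _).trans ?_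
        rw [h4, h5, abs_of_nonneg (by positivity)]
        nlinarith [sq_nonneg ‖u r‖]
      · filter_upwards [eventually_ge_atTop 0] with r hr
        positivity
      · filter_upwards [eventually_ge_atTop 0] with r hr
        have : 0 ≤ r * ‖u r‖ ^ 2 := by positivity
        linarith
    refine isLittleO_of_tendsto_mul_sq (hlim.congr' ?_)
    filter_upwards [eventually_ge_atTop 0] with r hr
    rw [norm_mul, Complex.norm_real, Real.norm_of_nonneg hr]
    ring

end IsProfileSolution

end Energy

/-! ### From the Teukolsky equation to the profile equation -/

section Profile

lemma hasDerivAt_phiBar {M a r : ℝ} (hM : 0 < M) (ha : |a| ≤ M) (hr : rPlus M a < r) :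
    HasDerivAt (phiBar M a) (a / Delta M a r) r := by
  have hc : ∀ x, rPlus M a < x → ContinuousAt (fun ρ => a / Delta M a ρ) x := fun x hx =>
    continuousAt_const.div (continuous_Delta M a).continuousAt (Delta_pos ha hx).ne'
  refine intervalIntegral.integral_hasDerivAt_right ?_ ?_ (hc r hr)
  · refine ContinuousOn.intervalIntegrable fun x hx => (hc x ?_).continuousWithinAt
    have := rPlus_lt M a hM
    exact (lt_min this hr).trans_le hx.1
  · exact ContinuousOn.stronglyMeasurableAtFilter isOpen_Ioi
      (fun x hx => (hc x hx).continuousWithinAt) r hr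

/-- The regular profile of a stationary mode solves the profile equation. -/
lemma isProfileSolution_regularProfile {M a s m lam : ℝ} {R : ℝ → ℂ} (hM : 0 < M) (ha : |a| ≤ M)
    (hR : IsRadialSolution M a s 0 m lam R) :
    IsProfileSolution M a (a * m) s (lam + 2 * s) (regularProfile M a s m R)
      (deriv (regularProfile M a s m R)) := by
  set E : ℝ → ℂ := fun r => ((Delta M a r ^ s : ℝ) : ℂ) *
    Complex.exp (-(Complex.I * m * (phiBar M a r : ℂ)))
  have hrpow : ∀ p r : ℝ, rPlus M a < r → HasDerivAt (fun ρ : ℝ => ((Delta M a ρ ^ p : ℝ) : ℂ))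
      (p * (2 * (r - M)) / Delta M a r * (Delta M a r ^ p : ℝ)) r := by
    intro p r hr
    have hD := Delta_pos ha hr
    have := ((hasDerivAt_Delta M a r).rpow_const (p := p) (Or.inl hD.ne')).ofReal_comp
    refine this.congr_deriv ?_
    rw [Real.rpow_sub_one hD.ne']
    push_cast
    ring
  -- The logarithmic derivative of the factor `E` relating `R` to its regular profile.
  set G : ℝ → ℂ := fun r => (s * (2 * (r - M)) - a * m * Complex.I) / Delta M a r
  have hEd : ∀ r, rPlus M a < r → HasDerivAt E (E r * G r) r := by
    intro r hr
    have h1 : HasDerivAt (fun r : ℝ => Complex.exp (-(Complex.I * m * (phiBar M a r : ℂ))))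
        (Complex.exp (-(Complex.I * m * (phiBar M a r : ℂ))) *
          -(Complex.I * m * (a / Delta M a r : ℝ))) r :=
      (((hasDerivAt_phiBar hM ha hr).ofReal_comp.const_mul (Complex.I * (m : ℂ))).neg).cexp
    refine ((hrpow s r hr).mul h1).congr_deriv ?_
    simp only [E, G]
    push_cast
    ring
  have hRd : ∀ r, rPlus M a < r → HasDerivAt R (deriv R r) r := fun r hr =>
    ((hR.1.differentiableOn two_ne_zero).differentiableAt (Ioi_mem_nhds hr)).hasDerivAt
  have hRdd : ∀ r, rPlus M a < r → HasDerivAt (deriv R) (deriv (deriv R) r) r := fun r hr =>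
    (((hR.1.deriv_of_isOpen (m := 1) isOpen_Ioi (by norm_num)).differentiableOn
      one_ne_zero).differentiableAt (Ioi_mem_nhds hr)).hasDerivAt
  have hfst : ∀ r, rPlus M a < r →
      HasDerivAt (regularProfile M a s m R) (E r * (deriv R r + G r * R r)) r := by
    intro r hr
    refine ((hEd r hr).mul (hRd r hr)).congr_deriv ?_
    ring
  have hGd : ∀ r, rPlus M a < r → HasDerivAt G
      ((s * (2 * 1) * Delta M a r - (s * (2 * (r - M)) - a * m * Complex.I) * (2 * (r - M)))
        / (Delta M a r : ℂ) ^ 2) r := by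
    intro r hr
    have hD : (Delta M a r : ℂ) ≠ 0 := by exact_mod_cast (Delta_pos ha hr).ne'
    exact ((((((hasDerivAt_id r).ofReal_comp).sub_const (M : ℂ)).const_mul 2).const_mul
      (s : ℂ)).sub_const _).div (hasDerivAt_Delta_ofReal M a r) hD
  refine ⟨fun r hr => (hfst r hr).differentiableAt.hasDerivAt, fun r hr => ?_⟩
  have hev : deriv (regularProfile M a s m R) =ᶠ[𝓝 r]
      fun r => E r * (deriv R r + G r * R r) := by
    filter_upwards [Ioi_mem_nhds hr] with x hx using (hfst x hx).deriv
  refine HasDerivAt.congr_of_eventuallyEq ?_ hev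
  refine ((hEd r hr).mul ((hRdd r hr).add ((hGd r hr).mul (hRd r hr)))).congr_deriv ?_
  have hDp := Delta_pos ha hr
  have hD : (Delta M a r : ℂ) ≠ 0 := by exact_mod_cast hDp.ne'
  have hode := hR.2 r hr
  have hpow : ((Delta M a r ^ (-s) : ℝ) : ℂ) * ((Delta M a r ^ (s + 1) : ℝ) : ℂ)
      = Delta M a r := by
    rw [← Complex.ofReal_mul, ← Real.rpow_add hDp]
    simp
  have hdd : deriv (fun ρ : ℝ => ((Delta M a ρ ^ (s + 1) : ℝ) : ℂ) * deriv R ρ) r = _ :=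
    ((hrpow (s + 1) r hr).mul (hRdd r hr)).deriv
  rw [hdd] at hode
  have hcancel : ((s + 1 : ℝ) * (2 * (r - M)) / Delta M a r : ℂ) * Delta M a r =
      (s + 1 : ℝ) * (2 * (r - M)) := div_mul_cancel₀ _ hD
  have hode' : ((s + 1 : ℝ) * (2 * (r - M)) : ℂ) * deriv R r + Delta M a r * deriv (deriv R) r
      + ((a * m) ^ 2 + 2 * Complex.I * s * (r - M) * (a * m)) / Delta M a r * R r
      - lam * R r = 0 := by
    linear_combination hode - (((s + 1 : ℝ) * (2 * (r - M)) / Delta M a r : ℂ) * deriv R r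
      + deriv (deriv R) r) * hpow - deriv R r * hcancel
  rw [(hfst r hr).deriv]
  have hΨ : regularProfile M a s m R r = E r * R r := rfl
  rw [hΨ]
  clear_value E
  simp only [Pi.mul_apply, Pi.add_apply, G]
  push_cast at hode' ⊢
  field_simp at hode' ⊢
  linear_combination E r * hode' - E r * R r * a ^ 2 * m ^ 2 * Complex.I_sq

end Profile

/-! ### Raising: integrability and kernel -/

namespace IsProfileSolution

variable {M a κ s c : ℝ} {u v : ℝ → ℂ}

lemma integrableOn_raised (h : IsProfileSolution M a κ s c u v) {b : ℝ}
    (hu : IntegrableOn (fun r => ‖u r‖ ^ 2) (Ioo (rPlus M a) b))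
    (hv : IntegrableOn (fun r => ‖v r‖ ^ 2) (Ioo (rPlus M a) b)) :
    IntegrableOn (fun r => ‖raised M a κ s u v r‖ ^ 2) (Ioo (rPlus M a) b) := by
  have hbdd : ∀ f : ℝ → ℂ, Continuous f → ∃ C : ℝ, ∀ r ∈ Ioo (rPlus M a) b, ‖f r‖ ^ 2 ≤ C := by
    intro f hf
    obtain ⟨C, hC⟩ := isCompact_Icc.bddAbove_image
      (K := Icc (rPlus M a) b) (f := fun r => ‖f r‖ ^ 2) (by fun_prop)
    exact ⟨C, fun r hr => hC ⟨r, Ioo_subset_Icc_self hr, rfl⟩⟩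
  obtain ⟨A, hA⟩ := hbdd (fun r => (Delta M a r : ℂ))
    (Complex.continuous_ofReal.comp (continuous_Delta M a))
  obtain ⟨B, hB⟩ := hbdd (fun r => -s * (2 * (r - M)) + 2 * κ * Complex.I) (by fun_prop)
  have hcu : ContinuousOn u (Ioo (rPlus M a) b) :=
    fun r hr => (h.fst r hr.1).continuousAt.continuousWithinAt
  have hcv : ContinuousOn v (Ioo (rPlus M a) b) :=
    fun r hr => (h.snd r hr.1).continuousAt.continuousWithinAt
  have hcr : ContinuousOn (raised M a κ s u v) (Ioo (rPlus M a) b) := by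
    refine ContinuousOn.add (ContinuousOn.mul ?_ hcv) (ContinuousOn.mul (by fun_prop) hcu)
    exact (Complex.continuous_ofReal.comp (continuous_Delta M a)).continuousOn
  refine ((hv.const_mul (2 * A)).add (hu.const_mul (2 * B))).mono'
    ((hcr.norm.pow 2).aestronglyMeasurable measurableSet_Ioo) ?_
  filter_upwards [ae_restrict_mem measurableSet_Ioo] with r hr
  have h1 := norm_add_le ((Delta M a r : ℂ) * v r) ((-s * (2 * (r - M)) + 2 * κ * Complex.I) * u r)
  rw [norm_mul, norm_mul] at h1
  rw [Real.norm_of_nonneg (sq_nonneg _), Pi.add_apply]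
  set x := ‖(Delta M a r : ℂ)‖
  set y := ‖(-s * (2 * (r - M)) + 2 * κ * Complex.I : ℂ)‖
  have h2 : ‖raised M a κ s u v r‖ ^ 2 ≤ (x * ‖v r‖ + y * ‖u r‖) ^ 2 :=
    pow_le_pow_left₀ (norm_nonneg _) h1 2
  have h3 := mul_le_mul_of_nonneg_right (hA r hr) (sq_nonneg ‖v r‖)
  have h4 := mul_le_mul_of_nonneg_right (hB r hr) (sq_nonneg ‖u r‖)
  nlinarith [sq_nonneg (x * ‖v r‖ - y * ‖u r‖)]

/-- On the kernel of the raising operator `|u|² Δ ^ (-2 s)` is constant. Since `u` has a limit at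
the horizon and `-2 s > 0`, that constant is zero. -/
lemma eq_zero_of_raised_eq_zero (h : IsProfileSolution M a κ s c u v) (ha : |a| ≤ M) (hs : s < 0)
    {b : ℝ} (hb : rPlus M a < b)
    (hu : IntegrableOn (fun r => ‖u r‖ ^ 2) (Ioo (rPlus M a) b))
    (hv : IntegrableOn (fun r => ‖v r‖ ^ 2) (Ioo (rPlus M a) b))
    (h0 : ∀ r, rPlus M a < r → raised M a κ s u v r = 0) {r : ℝ} (hr : rPlus M a < r) :
    u r = 0 := by
  set f : ℝ → ℂ := fun r => u r * star (u r) * ((Delta M a r ^ (-2 * s) : ℝ) : ℂ)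
  have hf : ∀ x, rPlus M a < x → HasDerivAt f 0 x := by
    intro x hx
    have hDp := Delta_pos ha hx
    have hD : (Delta M a x : ℂ) ≠ 0 := by exact_mod_cast hDp.ne'
    have h1 := h.fst x hx
    have h2 := ((hasDerivAt_Delta M a x).rpow_const (p := -2 * s) (Or.inl hDp.ne')).ofReal_comp
    refine ((h1.mul h1.star).mul h2).congr_deriv ?_
    have hv' : v x = (s * (2 * (x - M)) - 2 * κ * Complex.I) * u x / Delta M a x := by
      rw [eq_div_iff hD]
      have := h0 x hx
      rw [raised] at this
      linear_combination this
    rw [Real.rpow_sub_one hDp.ne', hv']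
    simp only [Complex.star_def, map_div₀, map_sub, map_mul, Complex.conj_ofReal,
      Complex.conj_I, map_ofNat, Pi.mul_apply]
    push_cast
    field_simp
    ring
  obtain ⟨⟨U, hU⟩, -⟩ := h.tendsto_horizon ha hb hu hv
  have hlim : Tendsto f (𝓝[>] rPlus M a) (𝓝 (U * star U * ((0 : ℝ) : ℂ))) := by
    refine (hU.mul hU.star).mul ((Complex.continuous_ofReal.tendsto 0).comp ?_)
    have hD : Tendsto (Delta M a) (𝓝[>] rPlus M a) (𝓝 0) := by
      rw [← Delta_rPlus M a ha]
      exact ((continuous_Delta M a).tendsto _).mono_left nhdsWithin_le_nhds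
    have := hD.rpow_const (p := -2 * s) (Or.inr (by linarith))
    rwa [Real.zero_rpow (by linarith)] at this
  have hfr : f r = 0 := by
    rw [Complex.ofReal_zero, mul_zero] at hlim
    refine tendsto_nhds_unique (tendsto_const_nhds.congr' ?_) hlim
    filter_upwards [Ioo_mem_nhdsGT hr] with t ht using eq_of_hasDerivAt_zero hf ht.1 ht.2.le
  have hpow : ((Delta M a r ^ (-2 * s) : ℝ) : ℂ) ≠ 0 := by
    exact_mod_cast (Real.rpow_pos_of_pos (Delta_pos ha hr) _).ne'
  simpa using (mul_eq_zero.1 hfr).resolve_right hpow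

end IsProfileSolution

/-! ### Induction on the spin -/

/-- Solutions that are square integrable with their derivative at the horizon, `o(r ^ q)` with
their scaled derivative at infinity, and above the threshold when `s < 0`, vanish. -/
def Vanishing (M a κ s q : ℝ) : Prop :=
  ∀ (c b : ℝ) (u v : ℝ → ℂ), IsProfileSolution M a κ s c u v → rPlus M a < b →
    IntegrableOn (fun r => ‖u r‖ ^ 2) (Ioo (rPlus M a) b) →
    IntegrableOn (fun r => ‖v r‖ ^ 2) (Ioo (rPlus M a) b) →
    (s < 0 → -(1 / 4) ≤ c - s) →
    u =o[atTop] (fun r : ℝ => r ^ q) →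
    (fun r : ℝ => (r : ℂ) * v r) =o[atTop] (fun r : ℝ => r ^ q) →
    ∀ r, rPlus M a < r → u r = 0

section Vanishing

variable {M a κ : ℝ}

/-- The decay is first improved from `-1/2` to `q`, which pays for the power of `r` lost in raising;
the kernel of the raising operator is trivial by `eq_zero_of_raised_eq_zero`. -/
lemma Vanishing.of_raised (hM : 0 < M) (ha : |a| ≤ M) {s q : ℝ} (hs : s ≤ -(1 / 2))
    (hq : -(3 / 2) ≤ q) (hq' : q < -(1 / 2)) (hsq : 2 * s - 1 / 2 < q)
    (hvan : Vanishing M a κ (s + 1) (q + 1)) : Vanishing M a κ s (-(1 / 2)) := by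
  intro c b u v h hb hu hv hthr hu' hv'
  have hs0 : s < 0 := by linarith
  have hthr := hthr hs0
  -- The threshold says `ν ≥ -s`, so the exponents `s - 1/2 ± ν` satisfy `pp ≥ -1/2` and `pm ≤ 2 s -
  -- 1/2 < q`.
  have hν : -s ≤ √((s - 1 / 2) ^ 2 + c) := Real.le_sqrt_of_sq_le (by linarith)
  have hν2 : √((s - 1 / 2) ^ 2 + c) ^ 2 = (s - 1 / 2) ^ 2 + c :=
    Real.sq_sqrt (by nlinarith [sq_nonneg s])
  set ν := √((s - 1 / 2) ^ 2 + c)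
  obtain ⟨hu'', hv''⟩ := h.isLittleO_improve hM (pp := s - 1 / 2 + ν) (pm := s - 1 / 2 - ν)
    (q' := q) (by ring) (by linarith) hu' hv' (by linarith) (by linarith) (by linarith)
    (by linarith)
  obtain ⟨hr1, hr2⟩ := IsProfileSolution.isLittleO_raised (a := a) (κ := κ) (s := s) (c := c)
    hM hu'' hv''
  intro r hr
  refine h.eq_zero_of_raised_eq_zero ha hs0 hb hu hv
    (hvan (c - 2 * s) b _ _ (by simpa using h.raise ha) hb (h.integrableOn_raised hu hv) ?_ ?_
      hr1 hr2) hr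
  · simp only [norm_mul, mul_pow]
    exact hu.const_mul _
  -- The threshold is inherited: `c - s` becomes `c - 3 s - 1`, which is no smaller because `s ≤
  -- -1/2`.
  · intro _
    linarith

lemma vanishing_spin_zero (hM : 0 < M) (ha : |a| ≤ M) (hκ : κ ≠ 0) :
    Vanishing M a κ 0 (-(1 / 2)) :=
  fun _ _ _ _ h hb hu hv _ hu' hv' _ hr => h.eq_zero_of_spin_zero hM ha hκ hb hu hv hu' hv' hr

lemma vanishing_spin_half (hM : 0 < M) (ha : |a| ≤ M) (hκ : κ ≠ 0) :
    Vanishing M a κ (1 / 2) 0 :=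
  fun _ _ _ _ h hb hu hv _ hu' hv' _ hr => h.eq_zero_of_spin_half hM ha hκ hb hu hv hu' hv' hr

lemma vanishing_neg_nat (hM : 0 < M) (ha : |a| ≤ M) (hκ : κ ≠ 0) (n : ℕ) :
    Vanishing M a κ (-n) (-(1 / 2)) := by
  induction n with
  | zero => simpa using vanishing_spin_zero hM ha hκ
  | succ n ih =>
    have hn : (0 : ℝ) ≤ n := n.cast_nonneg
    push_cast
    refine Vanishing.of_raised hM ha (q := -(3 / 2)) (by linarith) (by linarith) (by linarith)
      (by linarith) ?_
    convert ih using 1 <;> ring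

lemma vanishing_neg_half_sub_nat (hM : 0 < M) (ha : |a| ≤ M) (hκ : κ ≠ 0) (n : ℕ) :
    Vanishing M a κ (-(1 / 2) - n) (-(1 / 2)) := by
  induction n with
  | zero =>
    -- At `s = -1/2` the recessive bound `2 s - 1/2` equals `-3/2`, so a full power is not
    -- available; half a power suffices, since spin `1/2` only needs `o(1)`.
    refine Vanishing.of_raised hM ha (q := -1) (by simp) (by norm_num) (by norm_num)
      (by norm_num) ?_
    convert vanishing_spin_half hM ha hκ using 1 <;> norm_num
  | succ n ih =>
    have hn : (0 : ℝ) ≤ n := n.cast_nonneg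
    push_cast
    refine Vanishing.of_raised hM ha (q := -(3 / 2)) (by linarith) (by linarith) (by linarith)
      (by linarith) ?_
    convert ih using 1 <;> ring

lemma vanishing_neg (hM : 0 < M) (ha : |a| ≤ M) (hκ : κ ≠ 0) {s : ℝ} (hs : IsHalfIntegral s)
    (hs0 : s < 0) : Vanishing M a κ s (-(1 / 2)) := by
  obtain ⟨n, hn⟩ := hs
  have hn0 : n < 0 := by
    have : (n : ℝ) < 0 := by linarith
    exact_mod_cast this
  obtain ⟨k, rfl | rfl⟩ := n.even_or_odd'
  · obtain ⟨j, hj⟩ := Int.eq_ofNat_of_zero_le (show 0 ≤ -k by omega)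
    have hj' : -(k : ℝ) = j := by exact_mod_cast hj
    push_cast at hn
    rw [show s = -(j : ℝ) by linarith]
    exact vanishing_neg_nat hM ha hκ j
  · obtain ⟨j, hj⟩ := Int.eq_ofNat_of_zero_le (show 0 ≤ -k - 1 by omega)
    have hj' : -(k : ℝ) - 1 = j := by exact_mod_cast hj
    push_cast at hn
    rw [show s = -(1 / 2) - (j : ℝ) by linarith]
    exact vanishing_neg_half_sub_nat hM ha hκ j

/-- Nonnegative spin: the derivative of order `n` solves the equation of spin `s₀`. -/
lemma eq_zero_of_vanishing_sub {s₀ : ℝ} (hM : 0 < M) (ha : |a| ≤ M) (hs₀ : 0 ≤ s₀)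
    (hvan : Vanishing M a κ s₀ (-(1 / 2))) (n : ℕ) :
    ∀ (c b : ℝ) (u v : ℝ → ℂ), IsProfileSolution M a κ (s₀ + n) c u v → rPlus M a < b →
      IntegrableOn (fun r => ‖iteratedDeriv n u r‖ ^ 2) (Ioo (rPlus M a) b) →
      IntegrableOn (fun r => ‖iteratedDeriv (n + 1) u r‖ ^ 2) (Ioo (rPlus M a) b) →
      u =o[atTop] (fun r : ℝ => r ^ (-(1 / 2) : ℝ)) →
      (fun r : ℝ => (r : ℂ) * v r) =o[atTop] (fun r : ℝ => r ^ (-(1 / 2) : ℝ)) →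
      ∀ r, rPlus M a < r → u r = 0 := by
  induction n with
  | zero =>
    intro c b u v h hb hu hv hu' hv'
    rw [Nat.cast_zero, add_zero] at h
    refine hvan c b u v h hb (by simpa using hu) ?_ (fun hs => absurd hs₀ (not_le.2 hs)) hu' hv'
    refine hv.congr_fun (fun r hr => ?_) measurableSet_Ioo
    simp only [zero_add, iteratedDeriv_one, (h.fst r hr.1).deriv]
  | succ n ih =>
    intro c b u v h hb hu hv hu' hv' r hr
    have heq : EqOn (deriv u) v (Ioi (rPlus M a)) := fun r hr => (h.fst r hr).deriv
    have hiter : ∀ k, IntegrableOn (fun r => ‖iteratedDeriv (k + 1) u r‖ ^ 2) (Ioo (rPlus M a) b) →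
        IntegrableOn (fun r => ‖iteratedDeriv k v r‖ ^ 2) (Ioo (rPlus M a) b) := by
      intro k hk
      refine hk.congr_fun (fun r hr => ?_) measurableSet_Ioo
      simp only [iteratedDeriv_succ', heq.iteratedDeriv_of_isOpen isOpen_Ioi k hr.1]
    have hvd := IsProfileSolution.isLittleO_deriv hv'
    have hwd := IsProfileSolution.isLittleO_deriv_deriv (a := a) (κ := κ) (s := s₀ + (n + 1 : ℕ))
      (c := c) hM hu' hv'
    -- The derivative `u'` has spin lower by one and decays better than required, so the induction
    -- hypothesis gives `u' = 0`; `u` is then constant and tends to zero.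
    have hv0 := ih _ b v _ (by
        have := h.lower ha
        rwa [show s₀ + ((n + 1 : ℕ) : ℝ) - 1 = s₀ + n by push_cast; ring] at this) hb
      (hiter n hu) (hiter (n + 1) hv)
      (hvd.trans_isBigO (rpow_isBigO_rpow (by linarith)))
      (mul_isLittleO_rpow ofReal_isBigO hwd (by norm_num))
    refine eq_zero_of_hasDerivAt_zero (fun x hx => ?_) ?_ hr
    · simpa only [hv0 x hx] using h.fst x hx
    · have := hu'.trans_isBigO (rpow_isBigO_rpow (show (-(1 / 2) : ℝ) ≤ 0 by norm_num))
      simpa only [Real.rpow_zero, isLittleO_one_iff] using this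

end Vanishing

end Kerr

/-! ### Conclusion, by the sign of the spin -/

theorem mainTheorem8 (M a s m lam : ℝ) (hM : 0 < M) (ha : |a| ≤ M)
    (hs : Kerr.IsHalfIntegral s) (hm : Kerr.IsAdmissible s m) (ham : a * m ≠ 0)
    (R : ℝ → ℂ) (hR : Kerr.IsRadialSolution M a s 0 m lam R)
    (hE : Kerr.HasFiniteHyperboloidalEnergy M a s m lam R) :
    ∀ r : ℝ, Kerr.rPlus M a < r → R r = 0 := by
  intro r hr
  suffices hΨ : Kerr.regularProfile M a s m R r = 0 by
    have hD := (Real.rpow_pos_of_pos (Kerr.Delta_pos ha hr) s).ne'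
    simpa [Kerr.regularProfile, hD] using hΨ
  have h := Kerr.isProfileSolution_regularProfile hM ha hR
  obtain ⟨hu, hv⟩ := h.isLittleO_of_energy hM hE.energy
  obtain ⟨b, hb, hhor⟩ := hE.horizon
  rcases lt_or_ge s 0 with hs0 | hs0
  · refine Kerr.vanishing_neg hM ha ham hs hs0 _ b _ _ h hb (by simpa using hhor 0 (by omega))
      (by simpa using hhor 1 (by omega)) (fun _ => ?_) hu hv r hr
    linarith [hE.threshold hs0]
  · obtain ⟨s₀, hs₀, hsum⟩ : ∃ s₀ : ℝ, (s₀ = 0 ∨ s₀ = 1 / 2) ∧ s₀ + ⌊s⌋₊ = s := by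
      obtain ⟨n, hn⟩ := hs
      have h1 := Nat.floor_le hs0
      have h2 := Nat.lt_floor_add_one s
      refine ⟨s - ⌊s⌋₊, ?_, by ring⟩
      have h3 : (0 : ℝ) ≤ ((n - 2 * ⌊s⌋₊ : ℤ) : ℝ) := by push_cast; linarith
      have h4 : ((n - 2 * ⌊s⌋₊ : ℤ) : ℝ) < (2 : ℤ) := by push_cast; linarith
      have h3' : 0 ≤ n - 2 * (⌊s⌋₊ : ℤ) := by exact_mod_cast h3
      have h4' : n - 2 * (⌊s⌋₊ : ℤ) < 2 := by exact_mod_cast h4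
      obtain h5 | h5 : n - 2 * (⌊s⌋₊ : ℤ) = 0 ∨ n - 2 * (⌊s⌋₊ : ℤ) = 1 := by omega
      · have h6 : (n : ℝ) - 2 * (⌊s⌋₊ : ℝ) = 0 := by exact_mod_cast h5
        left; linarith
      · have h6 : (n : ℝ) - 2 * (⌊s⌋₊ : ℝ) = 1 := by exact_mod_cast h5
        right; linarith
    have hvan : Kerr.Vanishing M a (a * m) s₀ (-(1 / 2)) := by
      rcases hs₀ with rfl | rfl
      · exact Kerr.vanishing_spin_zero hM ha ham
      · exact fun c b u v h hb hu hv ht hu' hv' => Kerr.vanishing_spin_half hM ha ham c b u v h hb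
          hu hv ht (hu'.trans_isBigO (Kerr.rpow_isBigO_rpow (by norm_num)))
          (hv'.trans_isBigO (Kerr.rpow_isBigO_rpow (by norm_num)))
    have hs₀' : 0 ≤ s₀ := by rcases hs₀ with rfl | rfl <;> norm_num
    -- The horizon condition is used exactly at its top two orders `⌊s⌋` and `⌊s⌋ + 1`: the final
    -- function and its derivative after lowering to `s₀`.
    exact Kerr.eq_zero_of_vanishing_sub hM ha hs₀' hvan ⌊s⌋₊ _ b _ _ (by rwa [hsum]) hb
      (hhor _ (by omega)) (hhor _ le_rfl) hu hv r hr
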